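/- Let $\Gamma$ be a finite simplicial graph and let $W_\Gamma=\langle V(\Gamma)\mid s^2=1\ (s\in V(\Gamma)),\ st=ts\ (\{s,t\}\in E(\Gamma))\rangle$ be the right-angled Coxeter group it defines. A word in $V(\Gamma)$ is \emph{reduced} if no shorter word represents the same element of $W_\Gamma$. A \emph{$\Gamma$-labeled cube complex} is a cube complex (a CW complex whose cells are cubes, glued along faces by isometries; faces of a cube may be identified with each other, and edges may be loops) with a map from its set of edges to $V(\Gamma)$ such that (i) edges of a cube dual to a common midcube have the same label, and (ii) the labels of the edges of a cube at any one of its corners are pairwise distinct and pairwise adjacent in $\Gamma$. A \emph{path} is a simplicial path in the $1$-skeleton (possibly with backtracking), a \emph{loop} is a closed path, and the \emph{label} of a path is the word formed by the labels of its consecutive edges. The complex is \emph{folded} if no two distinct edges with the same label have a common endpoint, and, for $i\ge 2$, no two distinct $i$-cubes have the same boundary (that is, the same attaching map up to an isometry of the cube). It is \emph{cube-full} if, for $i\ge2$, any $i$ edges which are incident to a common vertex and whose labels form an $i$-clique of $\Gamma$ are contained in the boundary of some $i$-cube. Let $G$ be a subgroup of $W_\Gamma$. A connected $\Gamma$-labeled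 cube complex $\Omega$ with a base vertex $B$ is a \emph{completion} of $G$ if (1) $\Omega$ is folded and cube-full, (2) the label of every loop in $\Omega$ based at $B$ represents an element of $G$, and (3) every reduced word that represents an element of $G$ is the label of some loop in $\Omega$ based at $B$. \textbf{Theorem.} Suppose that $G$ is a torsion-free subgroup of $W_\Gamma$ and that $(\Omega,B)$ is a completion of $G$. Then the fundamental group of $\Omega$ (at any basepoint) is isomorphic to $G$. More precisely, there is an isomorphism $\phi:\pi_1(\Omega,B)\to G$ such that, for every loop $\alpha$ in the $1$-skeleton based at $B$, $\phi([\alpha])$ is the element of $W_\Gamma$ represented by the label of $\alpha$. Here the product in $\pi_1(\Omega, B)$ is concatenation of loops from left to right. -/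

import Mathlib

noncomputable section

namespace RACGCompletion

open Topology Topology.CWComplex

/-! ### Right-angled Coxeter groups -/

/-- The Coxeter matrix of a simple graph `Γ`: `m(s, s) = 1`, `m(s, t) = 2` if `s` and `t` are
adjacent, and `m(s, t) = ∞` (encoded as `0`, i.e. no relation) otherwise. -/
def coxeterMatrix {V : Type*} (Γ : SimpleGraph V) : CoxeterMatrix V where
  M := Matrix.of fun s t => by
    classical exact if s = t then 1 else if Γ.Adj s t then 2 else 0
  isSymm := by
    ext s t
    by_cases h : s = t
    · subst h; simp
    · by_cases h' : Γ.Adj s t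
      · simp [h, Ne.symm h, h', h'.symm]
      · simp [h, Ne.symm h, h', Γ.adj_comm t s]
  diagonal := by simp
  off_diagonal s t h := by
    simp only [Matrix.of_apply, if_neg h]
    split_ifs <;> simp

/-- The right-angled Coxeter group `W_Γ`. -/
abbrev RACG {V : Type*} (Γ : SimpleGraph V) : Type _ := (coxeterMatrix Γ).Group

/-- The standard Coxeter generating set `V(Γ)` of `W_Γ`. -/
abbrev standardSystem {V : Type*} (Γ : SimpleGraph V) :
    CoxeterSystem (coxeterMatrix Γ) (RACG Γ) := (coxeterMatrix Γ).toCoxeterSystem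

/-- The element of `W_Γ` represented by a word. -/
abbrev evalWord {V : Type*} (Γ : SimpleGraph V) (w : List V) : RACG Γ :=
  (standardSystem Γ).wordProd w

/-- A word is reduced if no word representing the same element of `W_Γ` is shorter. -/
def IsReducedWord {V : Type*} (Γ : SimpleGraph V) (w : List V) : Prop :=
  ∀ w' : List V, evalWord Γ w' = evalWord Γ w → w.length ≤ w'.length

/-! ### Cube complexes

A cube complex is a CW complex in the sense of Mathlib, whose `n`-cells are parametrized by the
closed unit ball of `Fin n → ℝ` in the maximum norm, i.e. by the cube `[-1, 1]ⁿ`, and whose cubes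
are glued along faces by isometries. (The side length of the cubes plays no role.) -/

/-- The isometry of the cube `[-1, 1]ⁿ` that permutes the coordinates by `σ` and changes signs
by `s`; all isometries of the cube are of this form. -/
def cubeIsometry {n : ℕ} (σ : Equiv.Perm (Fin n)) (s : Fin n → ℤˣ) (x : Fin n → ℝ) :
    Fin n → ℝ := fun j => ((s j : ℤ) : ℝ) * x (σ j)

section CubeComplex

variable (Ω : Type*) [TopologicalSpace Ω] [CWComplex (Set.univ : Set Ω)]

/-- The `n`-cubes of `Ω`. -/
abbrev Cube (n : ℕ) : Type _ := cell (Set.univ : Set Ω) n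

/-- The vertices of `Ω`. -/
abbrev Vertex : Type _ := Cube Ω 0

/-- The (closed, unoriented) edges of `Ω`. -/
abbrev Edge : Type _ := Cube Ω 1

/-- The CW complex `Ω` is a cube complex: for every `(n+1)`-cube `c`, the restriction of its
characteristic map to any of the codimension one faces `xᵢ = u`, `u = ±1`, of `[-1, 1]ⁿ⁺¹` is the
characteristic map of some `n`-cube `d`, up to an isometry of `[-1, 1]ⁿ`. -/
def IsCubeComplex : Prop :=
  ∀ (n : ℕ) (c : Cube Ω (n + 1)) (i : Fin (n + 1)) (u : ℤˣ),
    ∃ (d : Cube Ω n) (σ : Equiv.Perm (Fin n)) (s : Fin n → ℤˣ),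
      ∀ x ∈ Metric.closedBall (0 : Fin n → ℝ) 1,
        map (n + 1) c (i.insertNth (α := fun _ => ℝ) ((u : ℤ) : ℝ) x) =
          map n d (cubeIsometry σ s x)

variable {Ω}

/-- The point of `Ω` given by a vertex. -/
def vertexPoint (v : Vertex Ω) : Ω := map 0 v 0

/-- The two ends of an edge: `endpoint e 1` and `endpoint e (-1)`. -/
def endpoint (e : Edge Ω) (u : ℤˣ) : Ω := map 1 e fun _ => ((u : ℤ) : ℝ)

/-- The edge `e` is incident to the vertex `v`. -/
def Incident (e : Edge Ω) (v : Vertex Ω) : Prop := ∃ u : ℤˣ, endpoint e u = vertexPoint v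

/-- `e` is the edge of the cube `c` that issues in the `i`-th coordinate direction from the corner
`η ∈ {1, -1}ⁿ` of `c` (the value `η i` decides at which of its ends one stands). -/
def IsEdgeAt {n : ℕ} (c : Cube Ω n) (η : Fin n → ℤˣ) (i : Fin n) (e : Edge Ω) : Prop :=
  ∃ u : ℤˣ, ∀ t ∈ Set.Icc (-1 : ℝ) 1,
    map n c (Function.update (fun j => ((η j : ℤ) : ℝ)) i t) =
      map 1 e fun _ => ((u : ℤ) : ℝ) * t

/-- A `Γ`-labeling of a cube complex: edges of a cube dual to a common midcube have the same label,
and the labels of the edges of a cube at one of its corners are distinct and pairwise adjacent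
in `Γ`. -/
structure IsLabeling {V : Type*} (Γ : SimpleGraph V) (lab : Edge Ω → V) : Prop where
  parallel : ∀ (n : ℕ) (c : Cube Ω n) (i : Fin n) (η η' : Fin n → ℤˣ) (e e' : Edge Ω),
    IsEdgeAt c η i e → IsEdgeAt c η' i e' → lab e = lab e'
  clique : ∀ (n : ℕ) (c : Cube Ω n) (η : Fin n → ℤˣ) (i j : Fin n) (e e' : Edge Ω),
    i ≠ j → IsEdgeAt c η i e → IsEdgeAt c η j e' → Γ.Adj (lab e) (lab e')

/-- A labeled complex is folded if no fold and no cube identification is possible: distinct edges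
with the same label have no end in common, and distinct `n`-cubes, `n ≥ 2`, have distinct
boundaries, i.e. no isometry of `[-1, 1]ⁿ` takes one attaching map to the other. -/
structure IsFolded {V : Type*} (lab : Edge Ω → V) : Prop where
  edges : ∀ (e e' : Edge Ω) (u u' : ℤˣ), endpoint e u = endpoint e' u' → lab e = lab e' → e = e'
  cubes : ∀ (n : ℕ) (c c' : Cube Ω n), 2 ≤ n →
    (∃ (σ : Equiv.Perm (Fin n)) (s : Fin n → ℤˣ), ∀ x ∈ Metric.sphere (0 : Fin n → ℝ) 1,
      map n c x = map n c' (cubeIsometry σ s x)) → c = c'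

/-- A labeled complex is cube-full if all edges `e₁, …, eₙ`, `n ≥ 2`, that are incident to one
vertex and whose labels form an `n`-clique of `Γ`, are contained in the boundary of some
`n`-cube. -/
def IsCubeFull {V : Type*} (Γ : SimpleGraph V) (lab : Edge Ω → V) : Prop :=
  ∀ (n : ℕ) (v : Vertex Ω) (e : Fin n → Edge Ω), 2 ≤ n → (∀ k, Incident (e k) v) →
    (∀ k l, k ≠ l → Γ.Adj (lab (e k)) (lab (e l))) →
      ∃ c : Cube Ω n, ∀ k, ∃ (η : Fin n → ℤˣ) (i : Fin n), IsEdgeAt c η i (e k)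

/-! ### Simplicial paths and their labels -/

/-- Simplicial paths in the `1`-skeleton: finite sequences of consecutive oriented edges. The edge
`e` with orientation `u` is traversed from `endpoint e (-u)` to `endpoint e u`. -/
inductive EdgePath : Vertex Ω → Vertex Ω → Type _
  | nil (v : Vertex Ω) : EdgePath v v
  | cons {v v' w : Vertex Ω} (e : Edge Ω) (u : ℤˣ) (hv : endpoint e (-u) = vertexPoint v)
      (hv' : endpoint e u = vertexPoint v') (p : EdgePath v' w) : EdgePath v w

/-- The label of a simplicial path: the word of labels of its consecutive edges. -/
def EdgePath.label {V : Type*} (lab : Edge Ω → V) : {v w : Vertex Ω} → EdgePath v w → List V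
  | _, _, .nil _ => []
  | _, _, .cons e _ _ _ p => lab e :: EdgePath.label lab p

/-- The path in the space `Ω` that traverses the edge `e` with orientation `u`. -/
def orientedEdgePath (e : Edge Ω) (u : ℤˣ) : Path (endpoint e (-u)) (endpoint e u) where
  toFun t := map 1 e fun _ => ((u : ℤ) : ℝ) * (2 * (t : ℝ) - 1)
  continuous_toFun := by
    refine (Topology.CWComplex.continuousOn 1 e).comp_continuous (by fun_prop) fun t => ?_
    have h0 := t.2.1
    have h1 := t.2.2
    rw [mem_closedBall_zero_iff, pi_norm_le_iff_of_nonneg zero_le_one]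
    intro _
    rcases Int.units_eq_one_or u with rfl | rfl <;>
      · simp only [Units.val_one, Units.val_neg, Int.cast_one, Int.cast_neg, Real.norm_eq_abs]
        rw [abs_le]
        constructor <;> linarith
  source' := by simp [endpoint]
  target' := by
    simp only [endpoint, Set.Icc.coe_one]
    norm_num

/-- The path in the space `Ω` traced by a simplicial path. -/
def EdgePath.toPath : {v w : Vertex Ω} → EdgePath v w → Path (vertexPoint v) (vertexPoint w)
  | _, _, .nil v => Path.refl (vertexPoint v)
  | _, _, .cons e u hv hv' p => ((orientedEdgePath e u).cast hv.symm hv'.symm).trans p.toPath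

/-! ### Completions -/

/-- The connected `Γ`-labeled cube complex `(Ω, B)` with labeling `lab` is a completion of the
subgroup `G` of `W_Γ`. -/
structure IsCompletion {V : Type*} (Γ : SimpleGraph V) (lab : Edge Ω → V) (B : Vertex Ω)
    (G : Subgroup (RACG Γ)) : Prop where
  isCubeComplex : IsCubeComplex Ω
  isLabeling : IsLabeling Γ lab
  connected : ConnectedSpace Ω
  folded : IsFolded lab
  cubeFull : IsCubeFull Γ lab
  label_mem : ∀ p : EdgePath B B, evalWord Γ (p.label lab) ∈ G
  exists_loop : ∀ w : List V, IsReducedWord Γ w → evalWord Γ w ∈ G →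
    ∃ p : EdgePath B B, p.label lab = w

end CubeComplex

end RACGCompletion

end

/-! Torsion-freeness enters through `IsCompletion.corner_inj`. If two corners of a cube coincided, a
path between them inside the cube would be a loop. Its label, conjugated by a path from `B`, would
be an element of `G` of square 1, and it is nontrivial because the directions of a cube carry
distinct commuting generators. So every cube has distinct corners, and the rest of the argument
works with `HasDistinctCorners`.

The isomorphism then rests on three facts. Every path between vertices is homotopic to a simplicial
one (`exists_toClass_eq`): the open stars of the vertices form an open cover, and distinct corners
make them contractible along segments to the vertex.

Homotopic simplicial paths have labels representing the same element
(`evalWord_label_eq_of_toClass_eq`): gluing copies of the stars by the labels gives a covering of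
`Ω` with fiber `W_Γ`, whose monodromy along a simplicial path is right multiplication by its label
(`monodromy_toClass`).

Conversely, simplicial paths with the same ends whose labels agree in `W_Γ` are homotopic
(`toClass_eq_of_evalWord_eq`). A word representing 1 reduces to the empty word by swaps and
cancellations (`reflTransGen_nil_of_evalWord_eq_one`). A swap is a homotopy across a square, which
exists by cube-fullness, and a cancellation removes a backtrack, by foldedness.

Thus a loop class is determined by the value of its label, which lies in `G`, and every element of
`G` occurs because its reduced words label loops. -/

noncomputable section

namespace RACGCompletion

open Topology Topology.CWComplex

/-! ### The word problem in right-angled Coxeter groups. -/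

section Words

variable {V : Type*} (Γ : SimpleGraph V)

open Classical in
/-- Universal property of `W_Γ`: a map to a monoid that sends generators to involutions and
adjacent generators to commuting elements extends to `W_Γ`. -/
theorem isLiftable_coxeterMatrix {M : Type*} [Monoid M] (f : V → M) (hsq : ∀ s, f s * f s = 1)
    (hcomm : ∀ s t, Γ.Adj s t → f s * f t = f t * f s) : (coxeterMatrix Γ).IsLiftable f := by
  intro s t
  change (f s * f t) ^ (if s = t then 1 else if Γ.Adj s t then 2 else 0) = 1
  split_ifs with h h'
  · subst h; simp [hsq]
  · rw [pow_two]
    nth_rewrite 2 [hcomm s t h']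
    rw [mul_assoc, ← mul_assoc (f t), hsq, one_mul, hsq]
  · simp

open Classical in
theorem commute_simple {s t : V} (h : Γ.Adj s t) :
    Commute ((standardSystem Γ).simple s) ((standardSystem Γ).simple t) := by
  have h1 := (standardSystem Γ).simple_mul_simple_pow s t
  have h2 : (coxeterMatrix Γ).M s t = 2 := by
    change (if s = t then 1 else if Γ.Adj s t then 2 else 0) = 2
    simp [h, h.ne]
  rw [h2, pow_two] at h1
  have := eq_inv_of_mul_eq_one_left h1
  rw [mul_inv_rev, CoxeterSystem.inv_simple, CoxeterSystem.inv_simple] at this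
  exact this

/-- The sign homomorphism of `W_Γ` that detects the generator `s`. -/
def signHom (s : V) : RACG Γ →* ℤˣ := by
  classical
  exact (standardSystem Γ).lift ⟨fun t => if t = s then -1 else 1,
    isLiftable_coxeterMatrix Γ _ (fun t => by split_ifs <;> simp) fun _ _ _ => mul_comm _ _⟩

open Classical in
theorem signHom_simple (s t : V) :
    signHom Γ s ((standardSystem Γ).simple t) = if t = s then -1 else 1 := by
  rw [signHom, CoxeterSystem.lift_apply_simple]

/-- Elementary reductions of words: exchange of adjacent letters that commute, and cancellation
of a pair of equal adjacent letters. -/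
inductive WordStep : List V → List V → Prop
  | swap (s t : V) (l : List V) (h : Γ.Adj s t) : WordStep (s :: t :: l) (t :: s :: l)
  | cancel (s : V) (l : List V) : WordStep (s :: s :: l) l
  | cons (s : V) {l l' : List V} (h : WordStep l l') : WordStep (s :: l) (s :: l')

variable {Γ}

theorem WordStep.evalWord_eq {l l' : List V} (h : WordStep Γ l l') :
    evalWord Γ l = evalWord Γ l' := by
  induction h with
  | swap s t l h =>
    simp only [evalWord, CoxeterSystem.wordProd_cons, ← mul_assoc, (commute_simple Γ h).eq]
  | cancel s l =>
    simp only [evalWord, CoxeterSystem.wordProd_cons]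
    exact CoxeterSystem.simple_mul_simple_cancel_left _ _
  | cons s _ ih => simp only [evalWord, CoxeterSystem.wordProd_cons] at ih ⊢; rw [ih]

theorem evalWord_eq_of_reflTransGen {l l' : List V}
    (h : Relation.ReflTransGen (WordStep Γ) l l') : evalWord Γ l = evalWord Γ l' := by
  induction h with
  | refl => rfl
  | tail _ h ih => exact ih.trans h.evalWord_eq

theorem reflTransGen_cons (s : V) {l l' : List V} (h : Relation.ReflTransGen (WordStep Γ) l l') :
    Relation.ReflTransGen (WordStep Γ) (s :: l) (s :: l') :=
  h.lift _ fun _ _ h => h.cons s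

variable (Γ) in
/-- A word is irreducible if it has no two equal letters such that all letters between them
commute with them. -/
def IsIrred : List V → Prop
  | [] => True
  | s :: w => (∀ b c, w = b ++ s :: c → ∃ t ∈ b, ¬ Γ.Adj s t) ∧ IsIrred w

/-- Swaps carry the first `s` through `b` until it meets the second one and cancels. -/
theorem exists_shorter_aux (s : V) (b c : List V) (h : ∀ t ∈ b, Γ.Adj s t) :
    Relation.ReflTransGen (WordStep Γ) (s :: (b ++ s :: c)) (b ++ c) := by
  induction b with
  | nil => exact .single (.cancel s c)
  | cons t b ih =>
    exact .head (.swap s t _ (h t (by simp))) (reflTransGen_cons t (ih fun t ht => h t (by simp [ht])))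

theorem exists_shorter_of_not_isIrred (w : List V) (h : ¬ IsIrred Γ w) :
    ∃ w', Relation.ReflTransGen (WordStep Γ) w w' ∧ w'.length < w.length := by
  induction w with
  | nil => exact absurd trivial h
  | cons s w ih =>
    rw [IsIrred, not_and_or] at h
    rcases h with h | h
    · push Not at h
      obtain ⟨b, c, rfl, hb⟩ := h
      exact ⟨b ++ c, exists_shorter_aux s b c hb, by simp⟩
    · obtain ⟨w', h1, h2⟩ := ih h
      exact ⟨s :: w', reflTransGen_cons s h1, by simpa using h2⟩

/-! ### Commuting involutions on families of words. -/

section Toggle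

variable {ι : Type*} (A : Set ι) (s : V)

open Classical in
/-- Prepend the letter `s` to the words with index in `A`. -/
def consOn (x : ι → List V) : ι → List V := fun p => if p ∈ A then s :: x p else x p

open Classical in
/-- Remove the first letter of the words with index in `A`. -/
def tailOn (x : ι → List V) : ι → List V := fun p => if p ∈ A then (x p).tail else x p

open Classical in
/-- The length of the initial run of the letter `s` in a word. -/
def leadingCount (l : List V) : ℕ := (l.takeWhile (· = s)).length

/-- The length of the shortest initial run of `s` among the words with index in `A`. -/
def leadingInf (x : ι → List V) : ℕ := ⨅ p : A, leadingCount s (x p)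

open Classical in
/-- Cancel an initial `s` if the initial run of `s` is odd, and prepend `s` otherwise. -/
def toggle (x : ι → List V) : ι → List V :=
  -- The parity rule gives an involution on all families, so no invariant subset of admissible
  -- families is needed; with no common initial `s` the letter is prepended.
  if Odd (leadingInf A s x) then tailOn A x else consOn A s x

variable {A} {s}

theorem tailOn_consOn (x : ι → List V) : tailOn A (consOn A s x) = x := by
  ext1 p
  simp only [tailOn, consOn]
  split_ifs <;> rfl

theorem leadingCount_cons (l : List V) : leadingCount s (s :: l) = leadingCount s l + 1 := by
  simp [leadingCount]

/-- Nonemptiness matters: over an empty index set the infimum in `ℕ` is 0 on both sides. -/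
theorem leadingInf_consOn (hA : A.Nonempty) (x : ι → List V) :
    leadingInf A s (consOn A s x) = leadingInf A s x + 1 := by
  have := hA.to_subtype
  have key : ∀ p : A, leadingCount s (consOn A s x p) = leadingCount s (x p) + 1 := fun p => by
    rw [consOn, if_pos p.2, leadingCount_cons]
  simp only [leadingInf, key]
  obtain ⟨p, hp⟩ := ciInf_mem fun p : A => leadingCount s (x p)
  refine le_antisymm ?_ (le_ciInf fun q => by gcongr; exact ciInf_le' _ q)
  rw [← hp]
  exact ciInf_le' (fun p : A => leadingCount s (x p) + 1) p

/-- A nonzero infimum forces every word with index in `A` to start with `s`, so only letters `s` are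
removed. -/
theorem consOn_tailOn (x : ι → List V) (h : leadingInf A s x ≠ 0) :
    consOn A s (tailOn A x) = x := by
  ext1 p
  simp only [tailOn, consOn]
  split_ifs with hp
  · have h1 : leadingInf A s x ≤ leadingCount s (x p) :=
      ciInf_le' (fun p : A => leadingCount s (x p)) ⟨p, hp⟩
    cases hx : x p with
    | nil => simp [hx, leadingCount] at h1; omega
    | cons t l =>
      by_cases hts : t = s
      · simp [hts]
      · simp [hx, leadingCount, hts] at h1; omega
  · rfl

/-- Each toggle changes the parity of `leadingInf`, so the second one undoes the first. -/
theorem toggle_toggle (hA : A.Nonempty) (x : ι → List V) : toggle A s (toggle A s x) = x := by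
  by_cases h : Odd (leadingInf A s x)
  · have h0 : leadingInf A s x ≠ 0 := by rintro h'; simp [h'] at h
    have h1 := consOn_tailOn x h0
    have h2 := leadingInf_consOn (s := s) hA (tailOn A x)
    rw [h1] at h2
    have h3 : ¬ Odd (leadingInf A s (tailOn A x)) := by rw [h2] at h; grind
    rw [toggle, toggle, if_pos h, if_neg h3, h1]
  · have h3 : Odd (leadingInf A s (consOn A s x)) := by rw [leadingInf_consOn hA]; grind
    rw [toggle, toggle, if_neg h, if_pos h3, tailOn_consOn]

theorem toggle_apply_of_notMem (x : ι → List V) {p : ι} (hp : p ∉ A) : toggle A s x p = x p := by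
  unfold toggle
  split_ifs <;> simp [tailOn, consOn, hp]

/-- Toggling on `A` reads only the words indexed by `A`; this is why toggles on disjoint sets
commute. -/
theorem toggle_apply_congr {x y : ι → List V} (h : ∀ p ∈ A, x p = y p) {p : ι} (hp : p ∈ A) :
    toggle A s x p = toggle A s y p := by
  have : leadingInf A s x = leadingInf A s y := by
    simp only [leadingInf]
    congr! 2 with q
    rw [h q q.2]
  simp only [toggle, this]
  split_ifs <;> simp [tailOn, consOn, hp, h p hp]

theorem toggle_comm {A' : Set ι} {s' : V} (h : Disjoint A A') (x : ι → List V) :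
    toggle A s (toggle A' s' x) = toggle A' s' (toggle A s x) := by
  ext1 p
  have hd : ∀ q, q ∈ A → q ∉ A' := fun q h1 h2 => Set.disjoint_left.1 h h1 h2
  by_cases hp : p ∈ A
  · rw [toggle_apply_of_notMem _ (hd p hp)]
    exact toggle_apply_congr (fun q hq => toggle_apply_of_notMem _ (hd q hq)) hp
  · rw [toggle_apply_of_notMem _ hp]
    by_cases hp' : p ∈ A'
    · refine toggle_apply_congr (fun q hq => (toggle_apply_of_notMem _ fun h' => ?_).symm) hp'
      exact hd q h' hq
    · rw [toggle_apply_of_notMem _ hp', toggle_apply_of_notMem _ hp', toggle_apply_of_notMem _ hp]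

end Toggle

variable (Γ) in
/-- The non-commuting pairs that contain `s`, including the pair `{s, s}`. -/
def noncommPairs (s : V) : Set (Sym2 V) := {p | s ∈ p ∧ p ∉ Γ.edgeSet}

theorem noncommPairs_nonempty (s : V) : (noncommPairs Γ s).Nonempty :=
  ⟨s(s, s), by simp [noncommPairs]⟩

/-- The only pair containing both letters is `{s, t}`, which is an edge. -/
theorem disjoint_noncommPairs {s t : V} (h : Γ.Adj s t) :
    Disjoint (noncommPairs Γ s) (noncommPairs Γ t) := by
  refine Set.disjoint_left.2 fun p h1 h2 => h1.2 ?_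
  rw [(Sym2.mem_and_mem_iff h.ne).1 ⟨h1.1, h2.1⟩]
  exact h

variable (Γ) in
/-- The action of `W_Γ` on families of words indexed by pairs of letters, by toggling. -/
def toggleHom : RACG Γ →* Equiv.Perm (Sym2 V → List V) :=
  (standardSystem Γ).lift ⟨fun s => Function.Involutive.toPerm (toggle (noncommPairs Γ s) s)
      (toggle_toggle (noncommPairs_nonempty s)),
    isLiftable_coxeterMatrix Γ _
      (fun s => Equiv.ext fun x => toggle_toggle (noncommPairs_nonempty s) x)
      fun _ _ h => Equiv.ext fun x => toggle_comm (disjoint_noncommPairs h) x⟩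

theorem toggleHom_simple (s : V) (x : Sym2 V → List V) :
    toggleHom Γ ((standardSystem Γ).simple s) x = toggle (noncommPairs Γ s) s x := by
  rw [toggleHom, CoxeterSystem.lift_apply_simple]
  rfl

open Classical in
variable (Γ) in
/-- The projections of a word to the non-commuting pairs of letters. -/
def pairProj (w : List V) (p : Sym2 V) : List V :=
  if p ∈ Γ.edgeSet then [] else w.filter (· ∈ p)

/-- On an irreducible word every toggle prepends: before the letter `s` acts, some projection of the
rest of the word does not start with `s`, so the common initial run has length 0. -/
theorem toggleHom_evalWord (w : List V) (h : IsIrred Γ w) :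
    toggleHom Γ (evalWord Γ w) (fun _ => []) = pairProj Γ w := by
  classical
  induction w with
  | nil =>
    simp only [evalWord, CoxeterSystem.wordProd_nil, map_one]
    ext1 p
    simp [pairProj]
  | cons s w ih =>
    have ih := ih h.2
    simp only [evalWord, CoxeterSystem.wordProd_cons, map_mul] at ih ⊢
    rw [Equiv.Perm.mul_apply, ih, toggleHom_simple]
    have h0 : leadingInf (noncommPairs Γ s) s (pairProj Γ w) = 0 := by
      obtain ⟨p, hp, hp'⟩ : ∃ p ∈ noncommPairs Γ s, leadingCount s (pairProj Γ w p) = 0 := by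
        by_cases hs : s ∈ w
        -- `b` precedes the first `s` of `w`; irreducibility puts a `t` in `b` not commuting with
        -- `s`, so the projection to `{s, t}` starts with `t`.
        · obtain ⟨b, c, rfl, hb⟩ := List.eq_append_cons_of_mem hs
          obtain ⟨t, ht, hst⟩ := h.1 b c rfl
          refine ⟨s(s, t), by simp [noncommPairs, hst], ?_⟩
          have hne : b.filter (fun a => decide (a ∈ s(s, t))) ≠ [] :=
            List.ne_nil_of_mem (List.mem_filter.2 ⟨ht, by simp⟩)
          obtain ⟨a, l, hl⟩ := List.exists_cons_of_ne_nil hne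
          have ha : a ∈ b := (List.mem_filter.1 (hl ▸ List.mem_cons_self)).1
          have has : a ≠ s := fun h => hb (h ▸ ha)
          rw [pairProj, if_neg (by simpa using hst), List.filter_append, hl]
          simp [leadingCount, has]
        · refine ⟨s(s, s), by simp [noncommPairs], ?_⟩
          have : w.filter (fun a => decide (a ∈ s(s, s))) = [] :=
            List.filter_eq_nil_iff.2 fun a ha => by
              simp only [Sym2.mem_iff, or_self, decide_eq_true_eq]
              exact fun h => hs (h ▸ ha)
          rw [pairProj, if_neg (by simp), this]
          simp [leadingCount]
      exact Nat.eq_zero_of_le_zero (hp' ▸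
        ciInf_le' (fun p : noncommPairs Γ s => leadingCount s (pairProj Γ w p)) ⟨p, hp⟩)
    rw [toggle, if_neg (by simp [h0])]
    ext1 p
    by_cases h1 : p ∈ Γ.edgeSet
    · simp [consOn, noncommPairs, pairProj, h1]
    · by_cases h2 : s ∈ p <;> simp [consOn, noncommPairs, pairProj, h1, h2]

/-- The identity fixes the family of empty words, while the projection to `{s, s}` retains every
occurrence of `s`. -/
theorem eq_nil_of_isIrred {w : List V} (h : IsIrred Γ w) (hw : evalWord Γ w = 1) : w = [] := by
  classical
  have h1 := toggleHom_evalWord w h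
  rw [hw, map_one] at h1
  refine List.eq_nil_iff_forall_not_mem.2 fun s hs => ?_
  have h2 := congrFun h1 s(s, s)
  simp only [Equiv.Perm.coe_one, id, pairProj, SimpleGraph.mem_edgeSet, SimpleGraph.irrefl,
    if_false] at h2
  exact List.ne_nil_of_mem (List.mem_filter.2 ⟨hs, by simp⟩) h2.symm

/-- Solution of the word problem in `W_Γ`: a word that represents the identity can be transformed
into the empty word by exchanging commuting letters and cancelling pairs. -/
theorem reflTransGen_nil_of_evalWord_eq_one (w : List V) (hw : evalWord Γ w = 1) :
    Relation.ReflTransGen (WordStep Γ) w [] := by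
  induction hn : w.length using Nat.strong_induction_on generalizing w with
  | _ n ih =>
    by_cases h : IsIrred Γ w
    · rw [eq_nil_of_isIrred h hw]
    · obtain ⟨w', h1, h2⟩ := exists_shorter_of_not_isIrred w h
      exact h1.trans (ih _ (hn ▸ h2) w' ((evalWord_eq_of_reflTransGen h1).symm.trans hw) rfl)

theorem exists_isReducedWord (g : RACG Γ) : ∃ w, IsReducedWord Γ w ∧ evalWord Γ w = g := by
  have hne : {w | evalWord Γ w = g}.Nonempty := (standardSystem Γ).wordProd_surjective g
  refine ⟨Function.argminOn List.length _ hne, fun w' hw' => ?_,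
    Function.argminOn_mem List.length _ hne⟩
  refine Function.argminOn_le List.length _ ?_
  exact hw'.trans (Function.argminOn_mem List.length _ hne)

end Words

section Faces

/-! ### Faces of cubes -/

/-- The corner of `[-1, 1]ⁿ` with the given signs. -/
def corner {n : ℕ} (η : Fin n → ℤˣ) : Fin n → ℝ := fun j => ((η j : ℤ) : ℝ)

theorem abs_sign (u : ℤˣ) : |((u : ℤ) : ℝ)| = 1 := by
  rcases Int.units_eq_one_or u with rfl | rfl <;> simp

theorem sign_mul_sign (u : ℤˣ) : ((u : ℤ) : ℝ) * ((u : ℤ) : ℝ) = 1 := by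
  rcases Int.units_eq_one_or u with rfl | rfl <;> simp

theorem exists_sign_of_abs_eq_one {x : ℝ} (h : |x| = 1) : ∃ u : ℤˣ, ((u : ℤ) : ℝ) = x := by
  rcases eq_or_eq_neg_of_abs_eq h with rfl | rfl
  · exact ⟨1, by simp⟩
  · exact ⟨-1, by simp⟩

theorem mem_unitCube_iff {n : ℕ} {z : Fin n → ℝ} :
    z ∈ Metric.closedBall (0 : Fin n → ℝ) 1 ↔ ∀ i, |z i| ≤ 1 := by
  rw [mem_closedBall_zero_iff, pi_norm_le_iff_of_nonneg zero_le_one]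
  rfl

theorem mem_openCube_iff {n : ℕ} {z : Fin n → ℝ} :
    z ∈ Metric.ball (0 : Fin n → ℝ) 1 ↔ ∀ i, |z i| < 1 := by
  rw [mem_ball_zero_iff, pi_norm_lt_iff zero_lt_one]
  rfl

theorem corner_mem {n : ℕ} (η : Fin n → ℤˣ) : corner η ∈ Metric.closedBall (0 : Fin n → ℝ) 1 :=
  mem_unitCube_iff.2 fun i => (abs_sign (η i)).le

theorem update_corner_mem {n : ℕ} (η : Fin n → ℤˣ) (i : Fin n) {t : ℝ}
    (ht : t ∈ Set.Icc (-1 : ℝ) 1) :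
    Function.update (corner η) i t ∈ Metric.closedBall (0 : Fin n → ℝ) 1 := by
  refine mem_unitCube_iff.2 fun j => ?_
  rcases eq_or_ne j i with rfl | h
  · simpa [abs_le] using ht
  · simpa [h] using! (abs_sign (η j)).le

/-- The inclusion of `[-1, 1]ᵏ` as a face of `[-1, 1]ⁿ`: the coordinates in the range of `pos` are
free, the others are fixed and given by `ε`. -/
def faceMap {k n : ℕ} (pos : Fin k → Fin n) (ε : Fin n → ℤˣ) (y : Fin k → ℝ) : Fin n → ℝ :=
  -- Signs on the free coordinates and an arbitrary order of `pos` absorb the gluing isometries, so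
  -- in `IsFace` the characteristic maps agree exactly.
  Function.extend pos (fun a => ((ε (pos a) : ℤ) : ℝ) * y a) (corner ε)

/-- The corner of `[-1, 1]ⁿ` to which `faceMap` takes a corner of `[-1, 1]ᵏ`. -/
def faceSign {k n : ℕ} (pos : Fin k → Fin n) (ε : Fin n → ℤˣ) (θ : Fin k → ℤˣ) : Fin n → ℤˣ :=
  Function.extend pos (fun a => ε (pos a) * θ a) ε

section FaceMap

variable {k n : ℕ} {pos : Fin k → Fin n} (hpos : Function.Injective pos) (ε : Fin n → ℤˣ)

include hpos in
theorem faceMap_apply_pos (y : Fin k → ℝ) (a : Fin k) :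
    faceMap pos ε y (pos a) = ((ε (pos a) : ℤ) : ℝ) * y a := hpos.extend_apply _ _ _

theorem faceMap_apply_of_notMem (y : Fin k → ℝ) {j : Fin n} (hj : ¬ ∃ a, pos a = j) :
    faceMap pos ε y j = ((ε j : ℤ) : ℝ) := Function.extend_apply' _ _ _ hj

include hpos in
theorem faceSign_apply_pos (θ : Fin k → ℤˣ) (a : Fin k) :
    faceSign pos ε θ (pos a) = ε (pos a) * θ a := hpos.extend_apply _ _ _

theorem faceSign_apply_of_notMem (θ : Fin k → ℤˣ) {j : Fin n} (hj : ¬ ∃ a, pos a = j) :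
    faceSign pos ε θ j = ε j := Function.extend_apply' _ _ _ hj

include hpos in
theorem faceMap_corner (θ : Fin k → ℤˣ) :
    faceMap pos ε (corner θ) = corner (faceSign pos ε θ) := by
  ext1 j
  by_cases hj : ∃ a, pos a = j
  · obtain ⟨a, rfl⟩ := hj
    simp [faceMap_apply_pos hpos, faceSign_apply_pos hpos, corner]
  · simp [faceMap_apply_of_notMem _ _ hj, faceSign_apply_of_notMem _ _ hj, corner]

include hpos in
theorem faceMap_update_corner (θ : Fin k → ℤˣ) (a : Fin k) (t : ℝ) :
    faceMap pos ε (Function.update (corner θ) a t) =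
      Function.update (corner (faceSign pos ε θ)) (pos a) (((ε (pos a) : ℤ) : ℝ) * t) := by
  ext1 j
  by_cases hj : ∃ a, pos a = j
  · obtain ⟨b, rfl⟩ := hj
    rcases eq_or_ne b a with rfl | hb
    · simp [faceMap_apply_pos hpos]
    · simp [faceMap_apply_pos hpos, hb, hpos.ne hb, faceSign_apply_pos hpos, corner]
  · have : j ≠ pos a := fun h => hj ⟨a, h.symm⟩
    simp [faceMap_apply_of_notMem _ _ hj, this, faceSign_apply_of_notMem _ _ hj, corner]

include hpos in
theorem faceMap_lineMap (y y' : Fin k → ℝ) (t : ℝ) :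
    faceMap pos ε (AffineMap.lineMap y y' t) =
      AffineMap.lineMap (faceMap pos ε y) (faceMap pos ε y') t := by
  ext1 j
  simp only [AffineMap.lineMap_apply_module]
  by_cases hj : ∃ a, pos a = j
  · obtain ⟨a, rfl⟩ := hj
    simp [faceMap_apply_pos hpos]
    ring
  · simp [faceMap_apply_of_notMem _ _ hj]
    ring

include hpos in
theorem abs_faceMap_apply_pos (y : Fin k → ℝ) (a : Fin k) : |faceMap pos ε y (pos a)| = |y a| := by
  rw [faceMap_apply_pos hpos, abs_mul, abs_sign, one_mul]

include hpos in
theorem faceMap_mem {y : Fin k → ℝ} (hy : y ∈ Metric.closedBall (0 : Fin k → ℝ) 1) :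
    faceMap pos ε y ∈ Metric.closedBall (0 : Fin n → ℝ) 1 := by
  refine mem_unitCube_iff.2 fun j => ?_
  by_cases hj : ∃ a, pos a = j
  · obtain ⟨a, rfl⟩ := hj
    rw [abs_faceMap_apply_pos hpos]
    exact mem_unitCube_iff.1 hy a
  · rw [faceMap_apply_of_notMem _ _ hj, abs_sign]

end FaceMap

variable {Ω : Type*} [TopologicalSpace Ω] [CWComplex (Set.univ : Set Ω)]

/-- The cube `d` is the face of the cube `c` given by `faceMap pos ε`. -/
structure IsFace {k n : ℕ} (c : Cube Ω n) (pos : Fin k → Fin n) (ε : Fin n → ℤˣ)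
    (d : Cube Ω k) : Prop where
  injective : Function.Injective pos
  map_eq : ∀ y ∈ Metric.closedBall (0 : Fin k → ℝ) 1, map n c (faceMap pos ε y) = map k d y

/-- Every point of a closed cube is an inner point of some face. -/
theorem IsCubeComplex.exists_isFace (hΩ : IsCubeComplex Ω) {n : ℕ} (c : Cube Ω n) {z : Fin n → ℝ}
    (hz : z ∈ Metric.closedBall (0 : Fin n → ℝ) 1) :
    ∃ (k : ℕ) (pos : Fin k → Fin n) (ε : Fin n → ℤˣ) (d : Cube Ω k) (y : Fin k → ℝ),
      IsFace c pos ε d ∧ y ∈ Metric.ball (0 : Fin k → ℝ) 1 ∧ faceMap pos ε y = z := by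
  induction n with
  | zero =>
    have h : ∀ y : Fin 0 → ℝ, faceMap id 1 y = y := fun y => Subsingleton.elim _ _
    exact ⟨0, id, 1, c, z, ⟨fun _ _ h => h, fun y _ => by rw [h]⟩, mem_openCube_iff.2 fun i => i.elim0, h z⟩
  | succ n ih =>
    by_cases hz' : z ∈ Metric.ball (0 : Fin (n + 1) → ℝ) 1
    · have h : ∀ y : Fin (n + 1) → ℝ, faceMap id 1 y = y := fun y => funext fun j => by
        simpa using faceMap_apply_pos (pos := id) (fun _ _ h => h) 1 y j
      exact ⟨n + 1, id, 1, c, z, ⟨fun _ _ h => h, fun y _ => by rw [h]⟩, hz', h z⟩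
    · rw [mem_openCube_iff] at hz'
      rw [mem_unitCube_iff] at hz
      push Not at hz'
      obtain ⟨i, hi⟩ := hz'
      obtain ⟨u, hu⟩ := exists_sign_of_abs_eq_one (le_antisymm (hz i) hi)
      obtain ⟨d, σ, s, hd⟩ := hΩ n c i u
      have hz1 : cubeIsometry σ s (i.removeNth z) ∈ Metric.closedBall (0 : Fin n → ℝ) 1 := by
        refine mem_unitCube_iff.2 fun j => ?_
        rw [cubeIsometry, abs_mul, abs_sign, one_mul]
        exact hz _
      obtain ⟨k, pos, ε, d', y, hf, hy, hyz⟩ := ih d hz1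
      -- Inverting the gluing isometry shows that a face of a codimension one face is again given by
      -- a `faceMap`.
      have key : ∀ (x : Fin n → ℝ) (y : Fin k → ℝ), cubeIsometry σ s x = faceMap pos ε y →
          faceMap (fun a => i.succAbove (σ (pos a)))
            (i.insertNth (α := fun _ => ℤˣ) u fun m => s (σ.symm m) * ε (σ.symm m)) y =
          i.insertNth (α := fun _ => ℝ) ((u : ℤ) : ℝ) x := by
        intro x y hxy
        have hinj : Function.Injective fun a => i.succAbove (σ (pos a)) :=
          Fin.succAbove_right_injective.comp (σ.injective.comp hf.injective)
        have hx : ∀ m, x m = ((s (σ.symm m) : ℤ) : ℝ) * faceMap pos ε y (σ.symm m) := fun m => by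
          rw [← hxy, cubeIsometry, ← mul_assoc, sign_mul_sign, one_mul, σ.apply_symm_apply]
        ext1 j
        refine i.succAboveCases ?_ (fun m => ?_) j
        · rw [faceMap_apply_of_notMem _ _ fun ⟨a, ha⟩ => Fin.succAbove_ne _ _ ha]
          simp
        · rw [Fin.insertNth_apply_succAbove, hx]
          by_cases hm : ∃ a, pos a = σ.symm m
          · obtain ⟨a, ha⟩ := hm
            obtain rfl : σ (pos a) = m := by rw [ha, σ.apply_symm_apply]
            rw [faceMap_apply_pos hinj]
            simp [faceMap_apply_pos hf.injective, mul_assoc]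
          · rw [faceMap_apply_of_notMem _ _ hm, faceMap_apply_of_notMem]
            · simp
            · rintro ⟨a, ha⟩
              exact hm ⟨a, by rw [← Fin.succAbove_right_injective ha, σ.symm_apply_apply]⟩
      refine ⟨k, _, _, d', y, ⟨?_, fun y' hy' => ?_⟩, hy, (key (i.removeNth z) y hyz.symm).trans ?_⟩
      · exact Fin.succAbove_right_injective.comp (σ.injective.comp hf.injective)
      · let x : Fin n → ℝ := fun m => ((s (σ.symm m) : ℤ) : ℝ) * faceMap pos ε y' (σ.symm m)
        have hx : cubeIsometry σ s x = faceMap pos ε y' := funext fun j => by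
          simp only [cubeIsometry, x, σ.symm_apply_apply, ← mul_assoc, sign_mul_sign, one_mul]
        rw [key x y' hx, hd, hx, hf.map_eq y' hy']
        refine mem_unitCube_iff.2 fun m => ?_
        rw [abs_mul, abs_sign, one_mul]
        exact mem_unitCube_iff.1 (faceMap_mem hf.injective _ hy') _
      · rw [hu, Fin.insertNth_self_removeNth]

/-- Open cells are disjoint and characteristic maps are injective on them. Equality of triples lets
`cases` identify dimension, cube and point at once; comparisons of two presentations of a point go
through this. -/
theorem eq_of_map_eq_map {n m : ℕ} {c : Cube Ω n} {d : Cube Ω m} {z : Fin n → ℝ} {w : Fin m → ℝ}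
    (hz : z ∈ Metric.ball (0 : Fin n → ℝ) 1) (hw : w ∈ Metric.ball (0 : Fin m → ℝ) 1)
    (h : map n c z = map m d w) :
    (⟨n, c, z⟩ : Σ n, Cube Ω n × (Fin n → ℝ)) = ⟨m, d, w⟩ := by
  have h1 : (⟨n, c⟩ : Σ n, Cube Ω n) = ⟨m, d⟩ := by
    by_contra hne
    refine Set.disjoint_left.1 (disjoint_openCell_of_ne hne) ⟨z, hz, rfl⟩ ⟨w, hw, h.symm⟩
  cases h1
  have h2 := (map (C := (Set.univ : Set Ω)) n c).injOn (by rwa [source_eq]) (by rwa [source_eq]) h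
  rw [h2]

theorem IsCubeComplex.exists_map_eq (hΩ : IsCubeComplex Ω) (x : Ω) :
    ∃ (n : ℕ) (c : Cube Ω n) (z : Fin n → ℝ),
      z ∈ Metric.ball (0 : Fin n → ℝ) 1 ∧ map n c z = x := by
  have hx : x ∈ ⋃ (n : ℕ) (j : Cube Ω n), closedCell n j := by
    rw [CWComplex.union]; trivial
  simp only [Set.mem_iUnion] at hx
  obtain ⟨n, c, z, hz, rfl⟩ := hx
  obtain ⟨k, pos, ε, d, y, hf, hy, rfl⟩ := hΩ.exists_isFace c hz
  exact ⟨k, d, y, hy, (hf.map_eq y (Metric.ball_subset_closedBall hy)).symm⟩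

theorem vertexPoint_injective : Function.Injective (vertexPoint (Ω := Ω)) := fun v w h => by
  have := eq_of_map_eq_map (c := v) (d := w) (z := 0) (w := 0) (by simp) (by simp) h
  cases this
  rfl

theorem map_zero_eq_vertexPoint (v : Vertex Ω) (z : Fin 0 → ℝ) : map 0 v z = vertexPoint v := by
  rw [vertexPoint, Subsingleton.elim z 0]

/-- The face having the corner as an inner point has no free coordinate, since a free coordinate has
absolute value less than 1. -/
theorem IsCubeComplex.exists_vertexPoint_eq (hΩ : IsCubeComplex Ω) {n : ℕ} (c : Cube Ω n)
    (η : Fin n → ℤˣ) : ∃ v : Vertex Ω, vertexPoint v = map n c (corner η) := by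
  obtain ⟨k, pos, ε, d, y, hf, hy, h⟩ := hΩ.exists_isFace c (corner_mem η)
  obtain rfl : k = 0 := by
    by_contra hk
    have h1 := abs_faceMap_apply_pos hf.injective ε y ⟨0, Nat.pos_of_ne_zero hk⟩
    rw [h, corner, abs_sign] at h1
    exact (mem_openCube_iff.1 hy _).ne h1.symm
  exact ⟨d, by rw [← h, hf.map_eq y (Metric.ball_subset_closedBall hy), map_zero_eq_vertexPoint]⟩

/-- The edge is found as the face having its midpoint as an inner point: exactly the `i`-th
coordinate is free there. -/
theorem IsCubeComplex.exists_isEdgeAt (hΩ : IsCubeComplex Ω) {n : ℕ} (c : Cube Ω n)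
    (η : Fin n → ℤˣ) (i : Fin n) : ∃ e : Edge Ω, IsEdgeAt c η i e := by
  obtain ⟨k, pos, ε, d, y, hf, hy, h⟩ :=
    hΩ.exists_isFace c (update_corner_mem η i (t := 0) (by simp))
  have hpos : ∀ a, pos a = i := fun a => by
    by_contra hne
    have h1 := abs_faceMap_apply_pos hf.injective ε y a
    rw [h, Function.update_of_ne hne, corner, abs_sign] at h1
    exact (mem_openCube_iff.1 hy _).ne h1.symm
  obtain ⟨a, ha⟩ : ∃ a, pos a = i := by
    by_contra hne
    have h1 := faceMap_apply_of_notMem ε y hne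
    rw [h, Function.update_self] at h1
    have h2 := abs_sign (ε i)
    rw [← h1] at h2
    simp at h2
  obtain rfl : k = 1 := by
    have : Subsingleton (Fin k) := ⟨fun a b => hf.injective ((hpos a).trans (hpos b).symm)⟩
    have h1 := Fin.subsingleton_iff_le_one.1 this
    have h2 := a.2
    omega
  refine ⟨d, ε i, fun t ht => ?_⟩
  rw [← hf.map_eq]
  · congr 1
    ext1 j
    rcases eq_or_ne j i with rfl | hj
    · subst ha
      rw [faceMap_apply_pos hf.injective, ← mul_assoc, sign_mul_sign, one_mul, Function.update_self]
    · have hj' : ¬ ∃ a, pos a = j := fun ⟨b, hb⟩ => hj (hb ▸ hpos b)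
      have h1 := faceMap_apply_of_notMem ε y hj'
      rw [h] at h1
      rw [faceMap_apply_of_notMem _ _ hj', ← h1]
      simp [hj, corner]
  · refine mem_unitCube_iff.2 fun _ => ?_
    rw [abs_mul, abs_sign, one_mul, abs_le]
    exact ht

theorem IsFace.isEdgeAt {k n : ℕ} {c : Cube Ω n} {pos : Fin k → Fin n} {ε : Fin n → ℤˣ}
    {d : Cube Ω k} (hf : IsFace c pos ε d) {θ : Fin k → ℤˣ} {a : Fin k} {e : Edge Ω}
    (h : IsEdgeAt d θ a e) : IsEdgeAt c (faceSign pos ε θ) (pos a) e := by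
  obtain ⟨u, hu⟩ := h
  refine ⟨u * ε (pos a), fun t ht => ?_⟩
  have ht' : ((ε (pos a) : ℤ) : ℝ) * t ∈ Set.Icc (-1 : ℝ) 1 := by
    rw [Set.mem_Icc, ← abs_le, abs_mul, abs_sign, one_mul, abs_le]
    exact ht
  have h1 := faceMap_update_corner hf.injective ε θ a (((ε (pos a) : ℤ) : ℝ) * t)
  rw [← mul_assoc, sign_mul_sign, one_mul] at h1
  change map n c (Function.update (corner _) _ _) = _
  rw [← h1, hf.map_eq _ (update_corner_mem θ a ht')]
  refine (hu _ ht').trans ?_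
  push_cast
  simp only [mul_assoc]

end Faces

section Via

/-! ### Homotopy classes of paths through simply connected spaces -/

variable {X S S' : Type*} [TopologicalSpace X] [TopologicalSpace S] [TopologicalSpace S']
  [SimplyConnectedSpace S] [SimplyConnectedSpace S']

/-- The homotopy class of the image of any path from `a` to `b` in a simply connected space. -/
def via (F : C(S, X)) {x y : X} (a b : S) (ha : F a = x) (hb : F b = y) :
    Path.Homotopic.Quotient x y :=
  ((Path.Homotopic.Quotient.mk (PathConnectedSpace.somePath a b)).map F).cast ha.symm hb.symm

/-- Paths with the same ends in a simply connected space are homotopic, so the chosen path in `via`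
may be replaced by any other. -/
theorem mk_eq_via (F : C(S, X)) {x y : X} {a b : S} (γ : Path x y) (γ' : Path a b)
    (h : ∀ t, F (γ' t) = γ t) :
    Path.Homotopic.Quotient.mk γ = via F a b (by simpa using h 0) (by simpa using h 1) := by
  have hx : F a = x := by simpa using h 0
  have hy : F b = y := by simpa using h 1
  subst hx hy
  rw [via, Subsingleton.elim (Path.Homotopic.Quotient.mk (PathConnectedSpace.somePath a b))
    (Path.Homotopic.Quotient.mk γ'), Path.Homotopic.Quotient.cast_rfl_rfl,
    ← Path.Homotopic.Quotient.mk_map]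
  congr 1
  ext t
  exact (h t).symm

theorem via_self (F : C(S, X)) {x : X} (a : S) (ha : F a = x) :
    via F a a ha ha = Path.Homotopic.Quotient.refl x :=
  (mk_eq_via F (Path.refl x) (Path.refl a) fun _ => ha).symm

theorem via_trans (F : C(S, X)) {x y z : X} (a b c : S) (ha : F a = x) (hb : F b = y)
    (hc : F c = z) : (via F a b ha hb).trans (via F b c hb hc) = via F a c ha hc := by
  subst ha hb hc
  have h1 := mk_eq_via F ((PathConnectedSpace.somePath a b).map F.continuous) _ fun _ => rfl
  have h2 := mk_eq_via F ((PathConnectedSpace.somePath b c).map F.continuous) _ fun _ => rfl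
  rw [← h1, ← h2, ← Path.Homotopic.Quotient.mk_trans, ← Path.map_trans]
  exact mk_eq_via F _ _ fun _ => rfl

theorem via_eq_via (F : C(S, X)) (F' : C(S', X)) {x y : X} {a b : S} {a' b' : S'} (γ : Path a b)
    (γ' : Path a' b') (h : ∀ t, F (γ t) = F' (γ' t)) (ha : F a = x) (hb : F b = y)
    (ha' : F' a' = x) (hb' : F' b' = y) : via F a b ha hb = via F' a' b' ha' hb' := by
  subst ha hb
  exact (mk_eq_via F (γ.map F.continuous) γ fun _ => rfl).symm.trans
    (mk_eq_via F' (γ.map F.continuous) γ' fun t => (h t).symm)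

end Via

/-! ### Homotopy classes of paths inside one cube. -/

section CubeClass

variable {Ω : Type*} [TopologicalSpace Ω] [CWComplex (Set.univ : Set Ω)]

/-- The cube `[-1, 1]ⁿ`. -/
abbrev unitCube (n : ℕ) : Set (Fin n → ℝ) := Metric.closedBall (0 : Fin n → ℝ) 1

instance (n : ℕ) : ContractibleSpace (unitCube n) :=
  (convex_closedBall (0 : Fin n → ℝ) 1).contractibleSpace ⟨0, by simp⟩

/-- The characteristic map of a cube. -/
def cubeMap {n : ℕ} (c : Cube Ω n) : C(unitCube n, Ω) :=
  ⟨fun z => map n c z, (Topology.CWComplex.continuousOn n c).domRestrict⟩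

theorem cubeMap_apply {n : ℕ} (c : Cube Ω n) (z : unitCube n) : cubeMap c z = map n c z := rfl

/-- The segment between two points of the cube. -/
def cubeSegment {n : ℕ} (p q : unitCube n) : Path p q where
  toFun t := ⟨AffineMap.lineMap (p : Fin n → ℝ) (q : Fin n → ℝ) (t : ℝ),
    (convex_closedBall _ _).lineMap_mem p.2 q.2 t.2⟩
  continuous_toFun := by
    refine Continuous.subtype_mk ?_ _
    exact AffineMap.lineMap_continuous.comp continuous_subtype_val
  source' := by simp
  target' := by simp

theorem coe_cubeSegment {n : ℕ} (p q : unitCube n) (t : unitInterval) :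
    (cubeSegment p q t : Fin n → ℝ) = AffineMap.lineMap (p : Fin n → ℝ) (q : Fin n → ℝ) (t : ℝ) :=
  rfl

/-- The homotopy class of the image in `Ω` of any path in a cube. -/
def cubeClass {n : ℕ} (c : Cube Ω n) {p q : Fin n → ℝ} (hp : p ∈ unitCube n) (hq : q ∈ unitCube n)
    {x y : Ω} (hx : map n c p = x) (hy : map n c q = y) : Path.Homotopic.Quotient x y :=
  via (cubeMap c) ⟨p, hp⟩ ⟨q, hq⟩ hx hy

theorem cubeClass_self {n : ℕ} (c : Cube Ω n) {p : Fin n → ℝ} (hp : p ∈ unitCube n) {x : Ω}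
    (hx : map n c p = x) : cubeClass c hp hp hx hx = Path.Homotopic.Quotient.refl x :=
  via_self _ _ _

theorem cubeClass_trans {n : ℕ} (c : Cube Ω n) {p q r : Fin n → ℝ} (hp : p ∈ unitCube n)
    (hq : q ∈ unitCube n) (hr : r ∈ unitCube n) {x y z : Ω} (hx : map n c p = x)
    (hy : map n c q = y) (hz : map n c r = z) :
    (cubeClass c hp hq hx hy).trans (cubeClass c hq hr hy hz) = cubeClass c hp hr hx hz :=
  via_trans _ _ _ _ _ _ _

/-- Flip the sign of one coordinate. -/
def flip {n : ℕ} (i : Fin n) (η : Fin n → ℤˣ) : Fin n → ℤˣ := η * Pi.mulSingle i (-1)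

theorem flip_apply_self {n : ℕ} (i : Fin n) (η : Fin n → ℤˣ) : flip i η i = -η i := by simp [flip]

theorem flip_apply_of_ne {n : ℕ} {i j : Fin n} (h : j ≠ i) (η : Fin n → ℤˣ) :
    flip i η j = η j := by simp [flip, h]

theorem flip_flip {n : ℕ} (i : Fin n) (η : Fin n → ℤˣ) : flip i (flip i η) = η := by
  ext1 j
  rcases eq_or_ne j i with rfl | h <;> simp [flip, *]

theorem flip_comm {n : ℕ} (i j : Fin n) (η : Fin n → ℤˣ) :
    flip i (flip j η) = flip j (flip i η) := by
  simp only [flip, mul_assoc, mul_comm (Pi.mulSingle i _)]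

theorem corner_flip {n : ℕ} (i : Fin n) (η : Fin n → ℤˣ) :
    corner (flip i η) = Function.update (corner η) i (-((η i : ℤ) : ℝ)) := by
  ext1 j
  rcases eq_or_ne j i with rfl | h <;> simp [corner, flip, *]

/-- The edge `e`, traversed with orientation `u`, is the edge of the cube `c` in the `i`-th
direction that starts at the corner `η`. -/
def IsOrientedEdgeAt {n : ℕ} (c : Cube Ω n) (η : Fin n → ℤˣ) (i : Fin n) (e : Edge Ω) (u : ℤˣ) :
    Prop :=
  ∀ t ∈ Set.Icc (-1 : ℝ) 1,
    map n c (Function.update (corner η) i (-((η i : ℤ) : ℝ) * t)) =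
      map 1 e fun _ => ((u : ℤ) : ℝ) * t

theorem IsEdgeAt.exists_oriented {n : ℕ} {c : Cube Ω n} {η : Fin n → ℤˣ} {i : Fin n} {e : Edge Ω}
    (h : IsEdgeAt c η i e) : ∃ u, IsOrientedEdgeAt c η i e u := by
  obtain ⟨u, hu⟩ := h
  refine ⟨u * -η i, fun t ht => ?_⟩
  refine (hu (-((η i : ℤ) : ℝ) * t) ?_).trans ?_
  · rw [Set.mem_Icc, ← abs_le, abs_mul, abs_neg, abs_sign, one_mul, abs_le]
    exact ht
  · push_cast
    simp only [mul_assoc]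

namespace IsOrientedEdgeAt

variable {n : ℕ} {c : Cube Ω n} {η : Fin n → ℤˣ} {i : Fin n} {e : Edge Ω} {u : ℤˣ}

theorem reverse (h : IsOrientedEdgeAt c η i e u) : IsOrientedEdgeAt c (flip i η) i e (-u) := by
  intro t ht
  have := h (-t) (by simpa [and_comm, neg_le] using ht)
  rw [corner_flip, flip_apply_self, Function.update_idem]
  simpa using this

theorem isEdgeAt (h : IsOrientedEdgeAt c η i e u) : IsEdgeAt c η i e := by
  refine ⟨u * -η i, fun t ht => ?_⟩
  have := h (-((η i : ℤ) : ℝ) * t) (by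
    rw [Set.mem_Icc, ← abs_le, abs_mul, abs_neg, abs_sign, one_mul, abs_le]
    exact ht)
  rw [← mul_assoc, neg_mul_neg, sign_mul_sign, one_mul] at this
  refine this.trans ?_
  push_cast
  simp only [mul_assoc]

theorem endpoint_neg (h : IsOrientedEdgeAt c η i e u) :
    endpoint e (-u) = map n c (corner η) := by
  have := h (-1) (by simp)
  rw [mul_neg_one, neg_neg] at this
  rw [endpoint]
  simp only [mul_neg_one] at this
  push_cast
  rw [← this]
  congr 1
  exact Function.update_eq_self i (corner η)

theorem endpoint_self (h : IsOrientedEdgeAt c η i e u) :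
    endpoint e u = map n c (corner (flip i η)) := by
  have := h 1 (by simp)
  simp only [mul_one] at this
  rw [endpoint, corner_flip, this]

/-- The homotopy class of an edge of a cube. -/
theorem mk_orientedEdgePath (h : IsOrientedEdgeAt c η i e u) {x y : Ω} (hx : x = endpoint e (-u))
    (hy : y = endpoint e u) :
    Path.Homotopic.Quotient.mk ((orientedEdgePath e u).cast hx hy) =
      cubeClass c (corner_mem η) (corner_mem (flip i η)) (h.endpoint_neg.symm.trans hx.symm)
        (h.endpoint_self.symm.trans hy.symm) := by
  refine mk_eq_via (cubeMap c) _ (cubeSegment ⟨_, corner_mem η⟩ ⟨_, corner_mem (flip i η)⟩)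
    fun t => ?_
  have h0 := t.2.1
  have h1 := t.2.2
  refine Eq.trans ?_ (h (2 * t - 1) ⟨by linarith, by linarith⟩)
  rw [cubeMap_apply, coe_cubeSegment]
  congr 1
  ext1 j
  simp only [corner_flip, AffineMap.lineMap_apply_module, Pi.add_apply, Pi.smul_apply,
    smul_eq_mul]
  rcases eq_or_ne j i with rfl | hj
  · simp only [Function.update_self, corner]
    ring
  · simp only [Function.update_of_ne hj]
    ring

end IsOrientedEdgeAt

/-- An edge is itself a 1-cube, so the calculus of `cubeClass` applies to single edges. -/
theorem isOrientedEdgeAt_self (e : Edge Ω) (u : ℤˣ) :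
    IsOrientedEdgeAt e (fun _ => -u) 0 e u := by
  intro t _
  congr 1
  ext1 j
  obtain rfl := Subsingleton.elim j 0
  simp

theorem IsEdgeAt.exists_oriented_of_orientation {n : ℕ} {c : Cube Ω n} {η : Fin n → ℤˣ} {i : Fin n}
    {e : Edge Ω} (h : IsEdgeAt c η i e) (u : ℤˣ) : ∃ η', IsOrientedEdgeAt c η' i e u := by
  obtain ⟨u', hu'⟩ := h.exists_oriented
  rcases eq_or_ne u u' with rfl | hne
  · exact ⟨η, hu'⟩
  · have : u = -u' := by
      rcases Int.units_eq_one_or u with rfl | rfl <;>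
      rcases Int.units_eq_one_or u' with rfl | rfl <;> simp_all
    exact ⟨_, this ▸ hu'.reverse⟩

end CubeClass

section CubeLabels

variable {Ω : Type*} [TopologicalSpace Ω] [CWComplex (Set.univ : Set Ω)]

/-! ### Labels of cubes -/

variable {V : Type*} {Γ : SimpleGraph V} {lab : Edge Ω → V}

/-- The label of the edges of a cube in the `i`-th direction. -/
def cubeLab (hΩ : IsCubeComplex Ω) (lab : Edge Ω → V) {n : ℕ} (c : Cube Ω n) (i : Fin n) : V :=
  lab (hΩ.exists_isEdgeAt c 1 i).choose

theorem IsLabeling.lab_eq (hlab : IsLabeling Γ lab) (hΩ : IsCubeComplex Ω) {n : ℕ} {c : Cube Ω n}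
    {η : Fin n → ℤˣ} {i : Fin n} {e : Edge Ω} (he : IsEdgeAt c η i e) :
    lab e = cubeLab hΩ lab c i :=
  hlab.parallel n c i η 1 e _ he (hΩ.exists_isEdgeAt c 1 i).choose_spec

theorem IsLabeling.adj_cubeLab (hlab : IsLabeling Γ lab) (hΩ : IsCubeComplex Ω) {n : ℕ}
    (c : Cube Ω n) {i j : Fin n} (hij : i ≠ j) :
    Γ.Adj (cubeLab hΩ lab c i) (cubeLab hΩ lab c j) :=
  hlab.clique n c 1 i j _ _ hij (hΩ.exists_isEdgeAt c 1 i).choose_spec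
    (hΩ.exists_isEdgeAt c 1 j).choose_spec

theorem IsFace.cubeLab_eq (hlab : IsLabeling Γ lab) (hΩ : IsCubeComplex Ω) {k n : ℕ} {c : Cube Ω n}
    {pos : Fin k → Fin n} {ε : Fin n → ℤˣ} {d : Cube Ω k} (hf : IsFace c pos ε d) (a : Fin k) :
    cubeLab hΩ lab d a = cubeLab hΩ lab c (pos a) :=
  hlab.lab_eq hΩ (hf.isEdgeAt (hΩ.exists_isEdgeAt d 1 a).choose_spec)

variable (Γ) in
open Classical in
/-- The homomorphism from the group of signs that takes `-1` to the generator `s`. -/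
def genHom (s : V) : ℤˣ →* RACG Γ where
  toFun u := if u = -1 then (standardSystem Γ).simple s else 1
  map_one' := by
    rw [if_neg (by decide)]
  map_mul' u v := by
    have := (standardSystem Γ).simple_mul_simple_self s
    rcases Int.units_eq_one_or u with rfl | rfl <;>
    rcases Int.units_eq_one_or v with rfl | rfl <;> simp_all

theorem genHom_neg_one (s : V) : genHom Γ s (-1) = (standardSystem Γ).simple s :=
  by simp [genHom]

theorem commute_genHom {s t : V} (h : Γ.Adj s t) (u v : ℤˣ) :
    Commute (genHom Γ s u) (genHom Γ t v) := by
  rcases Int.units_eq_one_or u with rfl | rfl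
  · simp
  rcases Int.units_eq_one_or v with rfl | rfl
  · simp
  rw [genHom_neg_one, genHom_neg_one]
  exact commute_simple Γ h

theorem signHom_genHom_self (s : V) (u : ℤˣ) : signHom Γ s (genHom Γ s u) = u := by
  rcases Int.units_eq_one_or u with rfl | rfl
  · simp
  · rw [genHom_neg_one, signHom_simple, if_pos rfl]

theorem signHom_genHom_of_ne {s t : V} (h : t ≠ s) (u : ℤˣ) : signHom Γ s (genHom Γ t u) = 1 := by
  rcases Int.units_eq_one_or u with rfl | rfl
  · simp
  · rw [genHom_neg_one, signHom_simple, if_neg h]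

/-- The homomorphism to `W_Γ` that takes the sign change in the `i`-th direction of a cube to the
label of this direction. -/
def cubeHom (hΩ : IsCubeComplex Ω) (hlab : IsLabeling Γ lab) {n : ℕ} (c : Cube Ω n) :
    (Fin n → ℤˣ) →* RACG Γ :=
  MonoidHom.noncommPiCoprod (fun i => genHom Γ (cubeLab hΩ lab c i))
    fun _ _ hij _ _ => commute_genHom (hlab.adj_cubeLab hΩ c hij) _ _

section

variable (hΩ : IsCubeComplex Ω) (hlab : IsLabeling Γ lab)

theorem cubeHom_mulSingle {n : ℕ} (c : Cube Ω n) (i : Fin n) (u : ℤˣ) :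
    cubeHom hΩ hlab c (Pi.mulSingle i u) = genHom Γ (cubeLab hΩ lab c i) u :=
  MonoidHom.noncommPiCoprod_mulSingle _ _ _

theorem cubeHom_flip_mul {n : ℕ} (c : Cube Ω n) (η η' : Fin n → ℤˣ) (i : Fin n) :
    cubeHom hΩ hlab c (η * η') = (standardSystem Γ).simple (cubeLab hΩ lab c i) *
      cubeHom hΩ hlab c (flip i η * η') := by
  rw [← genHom_neg_one, ← cubeHom_mulSingle hΩ hlab, ← map_mul]
  congr 1
  rw [flip, mul_comm η (Pi.mulSingle i (-1)), mul_assoc, ← mul_assoc (Pi.mulSingle i (-1)),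
    ← Pi.mulSingle_mul]
  simp

/-- The directions of a cube have distinct labels, so the parity of one generator recovers one
coordinate. -/
theorem signHom_cubeHom {n : ℕ} (c : Cube Ω n) (i : Fin n) (η : Fin n → ℤˣ) :
    signHom Γ (cubeLab hΩ lab c i) (cubeHom hΩ hlab c η) = η i := by
  have : (signHom Γ (cubeLab hΩ lab c i)).comp (cubeHom hΩ hlab c) =
      Pi.evalMonoidHom (fun _ => ℤˣ) i := by
    refine MonoidHom.pi_ext fun j u => ?_
    rw [MonoidHom.comp_apply, cubeHom_mulSingle, Pi.evalMonoidHom_apply]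
    rcases eq_or_ne j i with rfl | hj
    · rw [signHom_genHom_self, Pi.mulSingle_eq_same]
    · rw [signHom_genHom_of_ne (hlab.adj_cubeLab hΩ c hj).ne, Pi.mulSingle_eq_of_ne hj.symm]
  exact DFunLike.congr_fun this η

theorem cubeHom_injective {n : ℕ} (c : Cube Ω n) : Function.Injective (cubeHom hΩ hlab c) :=
  fun η η' h => funext fun i => by
    rw [← signHom_cubeHom hΩ hlab c i η, h, signHom_cubeHom]

theorem cubeHom_self_mul_self {n : ℕ} (c : Cube Ω n) (η : Fin n → ℤˣ) :
    cubeHom hΩ hlab c (η * η) = 1 := by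
  rw [show η * η = 1 from funext fun i => Int.units_mul_self _, map_one]

theorem cubeHom_mul_mul {n : ℕ} (c : Cube Ω n) (η η' η'' : Fin n → ℤˣ) :
    cubeHom hΩ hlab c (η * η') * cubeHom hΩ hlab c (η' * η'') = cubeHom hΩ hlab c (η * η'') := by
  rw [← map_mul, mul_assoc, ← mul_assoc η', show η' * η' = 1 from funext fun i =>
    Int.units_mul_self _, one_mul]

/-- In the product of two corners of a face the signs `ε` cancel, leaving the extension of `θ * θ'`
by 1. -/
theorem IsFace.cubeHom_faceSign {k n : ℕ} {c : Cube Ω n} {pos : Fin k → Fin n} {ε : Fin n → ℤˣ}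
    {d : Cube Ω k} (hf : IsFace c pos ε d) (θ θ' : Fin k → ℤˣ) :
    cubeHom hΩ hlab c (faceSign pos ε θ * faceSign pos ε θ') = cubeHom hΩ hlab d (θ * θ') := by
  have h1 : faceSign pos ε θ * faceSign pos ε θ' = Function.ExtendByOne.hom ℤˣ pos (θ * θ') := by
    ext1 j
    by_cases hj : ∃ a, pos a = j
    · obtain ⟨a, rfl⟩ := hj
      simp only [Pi.mul_apply, faceSign_apply_pos hf.injective, Function.ExtendByOne.hom_apply,
        hf.injective.extend_apply]
      rw [mul_mul_mul_comm, Int.units_mul_self, one_mul]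
    · simp only [Pi.mul_apply, faceSign_apply_of_notMem _ _ hj, Function.ExtendByOne.hom_apply,
        Function.extend_apply' _ _ _ hj, Int.units_mul_self, Pi.one_apply]
  have h2 : (cubeHom hΩ hlab c).comp (Function.ExtendByOne.hom ℤˣ pos) = cubeHom hΩ hlab d := by
    refine MonoidHom.pi_ext fun a u => ?_
    rw [cubeHom_mulSingle, hf.cubeLab_eq hlab hΩ, ← cubeHom_mulSingle hΩ hlab c,
      MonoidHom.comp_apply]
    congr 1
    ext1 j
    rw [Function.ExtendByOne.hom_apply]
    by_cases hj : ∃ a, pos a = j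
    · obtain ⟨b, rfl⟩ := hj
      rw [hf.injective.extend_apply]
      rcases eq_or_ne b a with rfl | hb
      · simp
      · simp [hb, hf.injective.ne hb]
    · rw [Function.extend_apply' _ _ _ hj, Pi.mulSingle_eq_of_ne fun h => hj ⟨a, h.symm⟩]
      rfl
  rw [h1, ← h2]
  rfl

end

/-! ### Simplicial paths -/

namespace EdgePath

/-- Concatenation of simplicial paths. -/
def append : {v w x : Vertex Ω} → EdgePath v w → EdgePath w x → EdgePath v x
  | _, _, _, .nil _, q => q
  | _, _, _, .cons e u hv hv' p, q => .cons e u hv hv' (p.append q)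

/-- The reverse of a simplicial path. -/
def reverse : {v w : Vertex Ω} → EdgePath v w → EdgePath w v
  | _, _, .nil v => .nil v
  | _, _, .cons (v := v) e u hv hv' p =>
    p.reverse.append (.cons e (-u) ((neg_neg u).symm ▸ hv') hv (.nil v))

/-- The homotopy class of a simplicial path. -/
def toClass {v w : Vertex Ω} (p : EdgePath v w) :
    Path.Homotopic.Quotient (vertexPoint v) (vertexPoint w) :=
  Path.Homotopic.Quotient.mk p.toPath

/-- The homotopy class of an oriented edge. -/
def edgeClass (e : Edge Ω) (u : ℤˣ) {x y : Ω} (hx : endpoint e (-u) = x) (hy : endpoint e u = y) :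
    Path.Homotopic.Quotient x y :=
  Path.Homotopic.Quotient.mk ((orientedEdgePath e u).cast hx.symm hy.symm)

theorem toClass_nil (v : Vertex Ω) :
    (nil v).toClass = Path.Homotopic.Quotient.refl (vertexPoint v) := rfl

theorem toClass_cons {v v' w : Vertex Ω} (e : Edge Ω) (u : ℤˣ)
    (hv : endpoint e (-u) = vertexPoint v) (hv' : endpoint e u = vertexPoint v')
    (p : EdgePath v' w) : (cons e u hv hv' p).toClass = (edgeClass e u hv hv').trans p.toClass :=
  rfl

theorem toClass_append {v w x : Vertex Ω} (p : EdgePath v w) (q : EdgePath w x) :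
    (p.append q).toClass = p.toClass.trans q.toClass := by
  induction p with
  | nil v => simp [append, toClass_nil]
  | cons e u hv hv' p ih => rw [append, toClass_cons, ih, toClass_cons,
      Path.Homotopic.Quotient.trans_assoc]

theorem label_append {v w x : Vertex Ω} (p : EdgePath v w) (q : EdgePath w x) :
    (p.append q).label lab = p.label lab ++ q.label lab := by
  induction p with
  | nil v => rfl
  | cons e u hv hv' p ih => rw [append, label, ih, label, List.cons_append]

theorem label_reverse {v w : Vertex Ω} (p : EdgePath v w) :
    p.reverse.label lab = (p.label lab).reverse := by
  induction p with
  | nil v => rfl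
  | cons e u hv hv' p ih => simp [reverse, label_append, ih, label]

theorem toClass_reverse {v w : Vertex Ω} (p : EdgePath v w) :
    p.reverse.toClass = p.toClass.symm := by
  have key : p.reverse.toClass.trans p.toClass = Path.Homotopic.Quotient.refl _ := by
    induction p with
    | nil v => simp [reverse, toClass_nil]
    | cons e u hv hv' p ih =>
      have h1 := isOrientedEdgeAt_self e u
      have h2 : (edgeClass e (-u) ((neg_neg u).symm ▸ hv') hv).trans (edgeClass e u hv hv') =
          Path.Homotopic.Quotient.refl _ := by
        rw [edgeClass, h1.reverse.mk_orientedEdgePath, edgeClass, h1.mk_orientedEdgePath]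
        simp only [flip_flip]
        rw [cubeClass_trans, cubeClass_self]
      rw [reverse, toClass_append, toClass_cons, toClass_cons, toClass_nil,
        Path.Homotopic.Quotient.trans_refl, Path.Homotopic.Quotient.trans_assoc,
        ← Path.Homotopic.Quotient.trans_assoc (edgeClass _ _ _ _), h2,
        Path.Homotopic.Quotient.refl_trans, ih]
  rw [← Path.Homotopic.Quotient.trans_refl p.reverse.toClass,
    ← Path.Homotopic.Quotient.trans_symm p.toClass, ← Path.Homotopic.Quotient.trans_assoc, key,
    Path.Homotopic.Quotient.refl_trans]

end EdgePath

theorem IsOrientedEdgeAt.edgeClass_eq {n : ℕ} {c : Cube Ω n} {η : Fin n → ℤˣ} {i : Fin n}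
    {e : Edge Ω} {u : ℤˣ} (h : IsOrientedEdgeAt c η i e u) {x y : Ω}
    (hx : endpoint e (-u) = x) (hy : endpoint e u = y) :
    EdgePath.edgeClass e u hx hy =
      cubeClass c (corner_mem η) (corner_mem (flip i η)) (h.endpoint_neg.symm.trans hx)
        (h.endpoint_self.symm.trans hy) :=
  h.mk_orientedEdgePath hx.symm hy.symm

/-- Any two corners of a cube are joined by a simplicial path in the cube. -/
theorem exists_edgePath_cube (hΩ : IsCubeComplex Ω) (hlab : IsLabeling Γ lab) {n : ℕ}
    (c : Cube Ω n) (η η' : Fin n → ℤˣ) {v w : Vertex Ω} (hv : map n c (corner η) = vertexPoint v)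
    (hw : map n c (corner η') = vertexPoint w) :
    ∃ p : EdgePath v w, evalWord Γ (p.label lab) = cubeHom hΩ hlab c (η * η') ∧
      p.toClass = cubeClass c (corner_mem η) (corner_mem η') hv hw := by
  -- Induction on a set containing the coordinates in which the corners differ; each such coordinate
  -- contributes one edge.
  suffices ∀ (s : Finset (Fin n)) (η : Fin n → ℤˣ) (v : Vertex Ω)
      (hv : map n c (corner η) = vertexPoint v), (∀ i, η i ≠ η' i → i ∈ s) →
      ∃ p : EdgePath v w, evalWord Γ (p.label lab) = cubeHom hΩ hlab c (η * η') ∧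
        p.toClass = cubeClass c (corner_mem η) (corner_mem η') hv hw from
    this Finset.univ η v hv fun i _ => Finset.mem_univ i
  intro s
  induction s using Finset.induction_on with
  | empty =>
    intro η v hv h
    obtain rfl : η = η' := funext fun i => by simpa using h i
    obtain rfl := vertexPoint_injective (hv.symm.trans hw)
    refine ⟨.nil v, ?_, ?_⟩
    · rw [cubeHom_self_mul_self]
      exact CoxeterSystem.wordProd_nil _
    · rw [cubeClass_self, EdgePath.toClass_nil]
  | insert i s hi ih =>
    intro η v hv h
    by_cases hη : η i = η' i
    · refine ih η v hv fun j hj => (Finset.mem_insert.1 (h j hj)).resolve_left ?_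
      rintro rfl
      exact hj hη
    · obtain ⟨v', hv'⟩ := hΩ.exists_vertexPoint_eq c (flip i η)
      obtain ⟨p, hp1, hp2⟩ := ih (flip i η) v' hv'.symm fun j hj => by
        have hji : j ≠ i := by
          rintro rfl
          rw [flip_apply_self] at hj
          exact hj (Int.units_ne_iff_eq_neg.1 (Ne.symm hη)).symm
        rw [flip_apply_of_ne hji] at hj
        exact (Finset.mem_insert.1 (h j hj)).resolve_left hji
      obtain ⟨e, he⟩ := hΩ.exists_isEdgeAt c η i
      obtain ⟨u, hu⟩ := he.exists_oriented
      refine ⟨.cons e u (hu.endpoint_neg.trans hv) (hu.endpoint_self.trans hv'.symm) p, ?_, ?_⟩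
      · rw [EdgePath.label, hlab.lab_eq hΩ he, evalWord, CoxeterSystem.wordProd_cons,
          cubeHom_flip_mul hΩ hlab c η η' i, ← hp1]
      · rw [EdgePath.toClass_cons, hp2, hu.edgeClass_eq, cubeClass_trans]

/-! ### Connectedness of the `1`-skeleton -/

/-- In the weak topology closedness is tested on closed cells, and the hypothesis is symmetric in
`A` and its complement. -/
theorem IsCubeComplex.isClopen_of_forall_cube [T2Space Ω] {A : Set Ω}
    (hA : ∀ (n : ℕ) (c : Cube Ω n), closedCell n c ⊆ A ∨ closedCell n c ⊆ Aᶜ) : IsClopen A := by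
  have key : ∀ A : Set Ω, (∀ (n : ℕ) (c : Cube Ω n), closedCell n c ⊆ A ∨ closedCell n c ⊆ Aᶜ) →
      IsClosed A := fun A hA => by
    refine (CWComplex.closed (Set.univ : Set Ω) A (Set.subset_univ A)).2 fun n c => ?_
    rcases hA n c with h | h
    · rw [Set.inter_eq_self_of_subset_right h]
      exact isClosed_closedCell
    · rw [Set.disjoint_iff_inter_eq_empty.1 (Set.disjoint_left.2 fun x hx hx' => h hx' hx)]
      exact isClosed_empty
  refine ⟨key A hA, isClosed_compl_iff.1 (key Aᶜ fun n c => ?_)⟩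
  rw [compl_compl]
  exact (hA n c).symm

/-- The `1`-skeleton of a connected cube complex is connected. -/
theorem exists_edgePath [T2Space Ω] [ConnectedSpace Ω] (hΩ : IsCubeComplex Ω)
    (hlab : IsLabeling Γ lab) (B v : Vertex Ω) : Nonempty (EdgePath B v) := by
  let reach {n : ℕ} (c : Cube Ω n) : Prop :=
    ∃ η w, map n c (corner η) = vertexPoint w ∧ Nonempty (EdgePath B w)
  have hface : ∀ {k n : ℕ} {c : Cube Ω n} {pos : Fin k → Fin n} {ε : Fin n → ℤˣ} {d : Cube Ω k},
      IsFace c pos ε d → (reach d ↔ reach c) := by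
    intro k n c pos ε d hf
    have hcorner : ∀ θ, map n c (corner (faceSign pos ε θ)) = map k d (corner θ) := fun θ => by
      rw [← hf.map_eq _ (corner_mem θ), faceMap_corner hf.injective]
    constructor
    · rintro ⟨θ, w, hw, hp⟩
      exact ⟨_, w, (hcorner θ).trans hw, hp⟩
    · rintro ⟨η, w, hw, ⟨p⟩⟩
      obtain ⟨w', hw'⟩ := hΩ.exists_vertexPoint_eq d 1
      obtain ⟨q, -⟩ := exists_edgePath_cube hΩ hlab c η _ hw ((hcorner 1).trans hw'.symm)
      exact ⟨1, w', hw'.symm, ⟨p.append q⟩⟩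
  -- The union of the closed cubes with a reachable corner; it will be clopen, since reachability
  -- passes between a cube and its faces.
  let A : Set Ω := {x | ∃ (n : ℕ) (c : Cube Ω n) (z : Fin n → ℝ),
    z ∈ unitCube n ∧ map n c z = x ∧ reach c}
  have hA : ∀ (n : ℕ) (c : Cube Ω n) (z : Fin n → ℝ), z ∈ unitCube n →
      (map n c z ∈ A ↔ reach c) := by
    refine fun n c z hz => ⟨?_, fun h => ⟨n, c, z, hz, rfl, h⟩⟩
    rintro ⟨n', c', z', hz', h, hc'⟩
    obtain ⟨k, pos, ε, d, y, hf, hy, rfl⟩ := hΩ.exists_isFace c hz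
    obtain ⟨k', pos', ε', d', y', hf', hy', rfl⟩ := hΩ.exists_isFace c' hz'
    rw [hf.map_eq y (Metric.ball_subset_closedBall hy),
      hf'.map_eq y' (Metric.ball_subset_closedBall hy')] at h
    cases eq_of_map_eq_map hy' hy h
    exact (hface hf).1 ((hface hf').2 hc')
  have hclopen : IsClopen A := by
    refine IsCubeComplex.isClopen_of_forall_cube fun n c => ?_
    by_cases hc : reach c
    · left
      rintro _ ⟨z, hz, rfl⟩
      exact (hA n c z hz).2 hc
    · right
      rintro _ ⟨z, hz, rfl⟩
      exact fun h => hc ((hA n c z hz).1 h)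
  rcases isClopen_iff.1 hclopen with h | h
  · have hB : vertexPoint B ∈ A := ⟨0, B, 0, by simp, rfl, fun i => i.elim0, B,
      map_zero_eq_vertexPoint B _, ⟨.nil B⟩⟩
    rw [h] at hB
    exact absurd hB (Set.notMem_empty _)
  · have hv : map 0 v 0 ∈ A := by rw [h]; trivial
    obtain ⟨η, w, hw, hp⟩ := (hA 0 v 0 (by simp)).1 hv
    rw [map_zero_eq_vertexPoint] at hw
    exact vertexPoint_injective hw ▸ hp

/-- In a completion of a torsion-free subgroup, the corners of a cube are distinct. -/
theorem IsCompletion.corner_inj [T2Space Ω] {B : Vertex Ω} {G : Subgroup (RACG Γ)}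
    (h : IsCompletion Γ lab B G) (hG : ∀ g ∈ G, IsOfFinOrder g → g = 1) {n : ℕ} (c : Cube Ω n)
    {η η' : Fin n → ℤˣ} (hη : map n c (corner η) = map n c (corner η')) : η = η' := by
  have := h.connected
  have hΩ := h.isCubeComplex
  have hlab := h.isLabeling
  obtain ⟨v, hv⟩ := hΩ.exists_vertexPoint_eq c η
  obtain ⟨p⟩ := exists_edgePath hΩ hlab B v
  obtain ⟨q, hq, -⟩ := exists_edgePath_cube hΩ hlab c η η' hv.symm (hη.symm.trans hv.symm)
  have hmem := h.label_mem (p.append (q.append p.reverse))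
  simp only [EdgePath.label_append, EdgePath.label_reverse, evalWord, CoxeterSystem.wordProd_append,
    CoxeterSystem.wordProd_reverse] at hmem hq
  rw [hq, ← mul_assoc] at hmem
  -- The loop's label is a conjugate of the value of `cubeHom` at `η * η'`, whose square is 1.
  have h1 := hG _ hmem (isOfFinOrder_iff_pow_eq_one.2 ⟨2, by norm_num, by
    rw [conj_pow, ← map_pow, show (η * η') ^ 2 = 1 from funext fun i => Int.units_sq _]
    simp⟩)
  have h2 : cubeHom hΩ hlab c (η * η') = cubeHom hΩ hlab c (η' * η') := by
    rw [cubeHom_self_mul_self]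
    simpa using h1
  exact mul_right_cancel (cubeHom_injective hΩ hlab c h2)

end CubeLabels

section Stars

variable {Ω : Type*} [TopologicalSpace Ω] [CWComplex (Set.univ : Set Ω)]

/-! ### Open stars of vertices -/

/-- The complement of `A` meets each closed cell in the image of a compact set, which is closed as
`Ω` is Hausdorff. -/
theorem isOpen_of_forall_cube [T2Space Ω] {A : Set Ω} (hA : ∀ (n : ℕ) (c : Cube Ω n),
    ∃ O : Set (Fin n → ℝ), IsOpen O ∧ ∀ z ∈ unitCube n, map n c z ∈ A ↔ z ∈ O) : IsOpen A := by
  refine isClosed_compl_iff.1 ?_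
  refine (CWComplex.closed (Set.univ : Set Ω) _ (Set.subset_univ _)).2 fun n c => ?_
  obtain ⟨O, hO, h⟩ := hA n c
  have h1 : Aᶜ ∩ closedCell n c = map n c '' (unitCube n \ O) := by
    ext x
    constructor
    · rintro ⟨hx, z, hz, rfl⟩
      exact ⟨z, ⟨hz, fun hzO => hx ((h z hz).2 hzO)⟩, rfl⟩
    · rintro ⟨z, ⟨hz, hzO⟩, rfl⟩
      exact ⟨fun hx => hzO ((h z hz).1 hx), z, hz, rfl⟩
  rw [h1]
  refine IsCompact.isClosed (((isCompact_closedBall _ _).diff hO).image_of_continuousOn ?_)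
  exact (Topology.CWComplex.continuousOn n c).mono Set.sdiff_subset

/-- The point `z` of the cube `c` does not lie on any of the codimension one faces of `c` that are
opposite to the corner `η`, and this corner is the vertex `v`. -/
structure IsNear {n : ℕ} (v : Vertex Ω) (c : Cube Ω n) (z : Fin n → ℝ) (η : Fin n → ℤˣ) :
    Prop where
  corner_eq : map n c (corner η) = vertexPoint v
  ne : ∀ i, z i ≠ -((η i : ℤ) : ℝ)

theorem neg_one_lt_sign_mul {u : ℤˣ} {x : ℝ} (hx : |x| ≤ 1) :
    x ≠ -((u : ℤ) : ℝ) ↔ -1 < ((u : ℤ) : ℝ) * x := by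
  rw [abs_le] at hx
  rcases Int.units_eq_one_or u with rfl | rfl
  · simp only [Units.val_one, Int.cast_one, one_mul]
    exact ⟨fun h => lt_of_le_of_ne hx.1 h.symm, fun h => h.ne'⟩
  · simp only [Units.val_neg, Units.val_one, Int.cast_neg, Int.cast_one, neg_neg, neg_one_mul,
      neg_lt_neg_iff]
    exact ⟨fun h => lt_of_le_of_ne hx.2 h, fun h => h.ne⟩

/-- Within the cube, nearness reads `-1 < η i * z i`, a convex condition that holds at the corner.
-/
theorem IsNear.lineMap {n : ℕ} {v : Vertex Ω} {c : Cube Ω n} {z : Fin n → ℝ} {η : Fin n → ℤˣ}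
    (h : IsNear v c z η) (hz : z ∈ unitCube n) {t : ℝ} (ht : t ∈ Set.Icc (0 : ℝ) 1) :
    IsNear v c (AffineMap.lineMap (corner η) z t) η := by
  refine ⟨h.corner_eq, fun i => ?_⟩
  have h1 := (neg_one_lt_sign_mul (mem_unitCube_iff.1 hz i)).1 (h.ne i)
  have h2 := (convex_closedBall _ _).lineMap_mem (corner_mem η) hz ht
  rw [neg_one_lt_sign_mul (mem_unitCube_iff.1 h2 i), AffineMap.lineMap_apply_module]
  have h3 := sign_mul_sign (η i)
  simp only [Pi.add_apply, Pi.smul_apply, smul_eq_mul, corner]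
  obtain ⟨h4, h5⟩ := ht
  have h6 : ((η i : ℤ) : ℝ) * ((1 - t) * ((η i : ℤ) : ℝ) + t * z i) =
      (1 - t) + t * (((η i : ℤ) : ℝ) * z i) := by linear_combination (1 - t) * h3
  rw [h6]
  rcases h4.eq_or_lt with rfl | h4
  · norm_num
  · nlinarith [mul_pos h4 (neg_lt_iff_pos_add.1 h1)]

/-- The sign vector of a face that corresponds to a corner of the cube that lies on it. -/
theorem IsFace.faceSign_eq {k n : ℕ} {c : Cube Ω n} {pos : Fin k → Fin n} {ε : Fin n → ℤˣ}
    {d : Cube Ω k} (hf : IsFace c pos ε d) {y : Fin k → ℝ} {v : Vertex Ω} {η : Fin n → ℤˣ}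
    (h : IsNear v c (faceMap pos ε y) η) :
    faceSign pos ε (fun a => ε (pos a) * η (pos a)) = η := by
  ext1 j
  by_cases hj : ∃ a, pos a = j
  · obtain ⟨a, rfl⟩ := hj
    rw [faceSign_apply_pos hf.injective, ← mul_assoc, Int.units_mul_self, one_mul]
  · rw [faceSign_apply_of_notMem _ _ hj]
    -- A fixed coordinate of the point equals `ε j` and differs from `-η j`, so the two signs agree.
    have h1 := h.ne j
    rw [faceMap_apply_of_notMem _ _ hj] at h1
    by_contra hne
    rw [Int.units_ne_iff_eq_neg.1 hne] at h1
    simp at h1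

theorem IsFace.map_corner {k n : ℕ} {c : Cube Ω n} {pos : Fin k → Fin n} {ε : Fin n → ℤˣ}
    {d : Cube Ω k} (hf : IsFace c pos ε d) (θ : Fin k → ℤˣ) :
    map n c (corner (faceSign pos ε θ)) = map k d (corner θ) := by
  rw [← hf.map_eq _ (corner_mem θ), faceMap_corner hf.injective]

theorem IsFace.isNear {k n : ℕ} {c : Cube Ω n} {pos : Fin k → Fin n} {ε : Fin n → ℤˣ}
    {d : Cube Ω k} (hf : IsFace c pos ε d) {y : Fin k → ℝ}
    (hy : y ∈ Metric.ball (0 : Fin k → ℝ) 1) {v : Vertex Ω} {η : Fin n → ℤˣ}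
    (h : IsNear v c (faceMap pos ε y) η) : IsNear v d y fun a => ε (pos a) * η (pos a) := by
  refine ⟨?_, fun a ha => ?_⟩
  · rw [← hf.map_corner, hf.faceSign_eq h, h.corner_eq]
  · have h1 := mem_openCube_iff.1 hy a
    rw [ha, abs_neg, abs_sign] at h1
    exact h1.ne rfl

theorem IsFace.isNear_faceSign {k n : ℕ} {c : Cube Ω n} {pos : Fin k → Fin n} {ε : Fin n → ℤˣ}
    {d : Cube Ω k} (hf : IsFace c pos ε d) {y : Fin k → ℝ}
    (hy : y ∈ Metric.ball (0 : Fin k → ℝ) 1) {v : Vertex Ω} {θ : Fin k → ℤˣ}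
    (h : IsNear v d y θ) : IsNear v c (faceMap pos ε y) (faceSign pos ε θ) := by
  refine ⟨by rw [hf.map_corner, h.corner_eq], fun j hj' => ?_⟩
  by_cases hj : ∃ a, pos a = j
  · obtain ⟨a, rfl⟩ := hj
    have h1 := mem_openCube_iff.1 hy a
    rw [← abs_faceMap_apply_pos hf.injective ε, hj', abs_neg, abs_sign] at h1
    exact h1.ne rfl
  · rw [faceMap_apply_of_notMem _ _ hj, faceSign_apply_of_notMem _ _ hj] at hj'
    have := abs_sign (ε j)
    rw [show ((ε j : ℤ) : ℝ) = 0 by linarith, abs_zero] at this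
    exact zero_ne_one this

/-- The open star of a vertex. -/
def openStar (v : Vertex Ω) : Set Ω :=
  {x | ∃ (n : ℕ) (c : Cube Ω n) (z : Fin n → ℝ) (η : Fin n → ℤˣ),
    z ∈ unitCube n ∧ map n c z = x ∧ IsNear v c z η}

/-- Nearness passes from any cube down to the unique cube having the point as an inner point, and
back up to `c`. -/
theorem IsCubeComplex.map_mem_openStar_iff (hΩ : IsCubeComplex Ω) {n : ℕ} (c : Cube Ω n)
    {z : Fin n → ℝ} (hz : z ∈ unitCube n) (v : Vertex Ω) :
    map n c z ∈ openStar v ↔ ∃ η, IsNear v c z η := by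
  refine ⟨?_, fun ⟨η, h⟩ => ⟨n, c, z, η, hz, rfl, h⟩⟩
  rintro ⟨n', c', z', η', hz', h, hη'⟩
  obtain ⟨k, pos, ε, d, y, hf, hy, rfl⟩ := hΩ.exists_isFace c hz
  obtain ⟨k', pos', ε', d', y', hf', hy', rfl⟩ := hΩ.exists_isFace c' hz'
  rw [hf.map_eq y (Metric.ball_subset_closedBall hy),
    hf'.map_eq y' (Metric.ball_subset_closedBall hy')] at h
  cases eq_of_map_eq_map hy' hy h
  exact ⟨_, hf.isNear_faceSign hy (hf'.isNear hy hη')⟩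

theorem vertexPoint_mem_openStar (v : Vertex Ω) : vertexPoint v ∈ openStar v :=
  ⟨0, v, 0, fun i => i.elim0, by simp, rfl, map_zero_eq_vertexPoint v _, fun i => i.elim0⟩

theorem isOpen_setOf_ne {n : ℕ} (η : Fin n → ℤˣ) :
    IsOpen {z : Fin n → ℝ | ∀ i, z i ≠ -((η i : ℤ) : ℝ)} := by
  simp only [Set.ofPred_forall]
  exact isOpen_iInter_of_finite fun i => isOpen_ne_fun (continuous_apply i) continuous_const

theorem IsCubeComplex.isOpen_openStar [T2Space Ω] (hΩ : IsCubeComplex Ω) (v : Vertex Ω) :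
    IsOpen (openStar v) := by
  refine isOpen_of_forall_cube fun n c => ⟨{z | ∃ η, IsNear v c z η}, ?_, fun z hz =>
    hΩ.map_mem_openStar_iff c hz v⟩
  simp only [Set.ofPred_exists]
  refine isOpen_iUnion fun η => ?_
  by_cases h : map n c (corner η) = vertexPoint v
  · convert isOpen_setOf_ne η using 1
    ext z
    exact ⟨fun h => h.ne, fun h' => ⟨h, h'⟩⟩
  · convert isOpen_empty
    exact Set.eq_empty_iff_forall_notMem.2 fun z hz => h hz.corner_eq

theorem IsCubeComplex.exists_mem_openStar (hΩ : IsCubeComplex Ω) (x : Ω) :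
    ∃ v : Vertex Ω, x ∈ openStar v := by
  obtain ⟨n, c, z, hz, rfl⟩ := hΩ.exists_map_eq x
  obtain ⟨v, hv⟩ := hΩ.exists_vertexPoint_eq c 1
  refine ⟨v, n, c, z, 1, Metric.ball_subset_closedBall hz, rfl, hv.symm, fun i hi => ?_⟩
  have h1 := mem_openCube_iff.1 hz i
  rw [hi, abs_neg, abs_sign] at h1
  exact h1.ne rfl

variable (Ω) in
/-- The corners of every cube are distinct. -/
def HasDistinctCorners : Prop :=
  ∀ (n : ℕ) (c : Cube Ω n) (η η' : Fin n → ℤˣ),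
    map n c (corner η) = map n c (corner η') → η = η'

/-- Two presentations of a point in the open star of `v` define the same segment to `v`. -/
theorem IsNear.map_lineMap_eq (hΩ : IsCubeComplex Ω) (hinj : HasDistinctCorners Ω) {v : Vertex Ω}
    {n n' : ℕ} {c : Cube Ω n} {c' : Cube Ω n'} {z : Fin n → ℝ} {z' : Fin n' → ℝ} {η : Fin n → ℤˣ}
    {η' : Fin n' → ℤˣ} (h : IsNear v c z η) (h' : IsNear v c' z' η') (hz : z ∈ unitCube n)
    (hz' : z' ∈ unitCube n') (heq : map n c z = map n' c' z') {t : ℝ}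
    (ht : t ∈ Set.Icc (0 : ℝ) 1) :
    map n c (AffineMap.lineMap (corner η) z t) = map n' c' (AffineMap.lineMap (corner η') z' t) := by
  obtain ⟨k, pos, ε, d, y, hf, hy, rfl⟩ := hΩ.exists_isFace c hz
  obtain ⟨k', pos', ε', d', y', hf', hy', rfl⟩ := hΩ.exists_isFace c' hz'
  rw [hf.map_eq y (Metric.ball_subset_closedBall hy),
    hf'.map_eq y' (Metric.ball_subset_closedBall hy')] at heq
  cases eq_of_map_eq_map hy hy' heq
  have h1 := hf.isNear hy h
  have h2 := hf'.isNear hy h'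
  -- In the common smallest cube both corners map to `v`, so they coincide and the two segments
  -- agree.
  have h3 := hinj k d _ _ (h1.corner_eq.trans h2.corner_eq.symm)
  rw [← hf.faceSign_eq h, ← hf'.faceSign_eq h', ← faceMap_corner hf.injective,
    ← faceMap_corner hf'.injective, ← faceMap_lineMap hf.injective, ← faceMap_lineMap hf'.injective,
    hf.map_eq, hf'.map_eq, h3]
  all_goals
    exact (convex_closedBall _ _).lineMap_mem (corner_mem _) (Metric.ball_subset_closedBall hy) ht

section Contraction

variable (v : Vertex Ω)

/-- The segment of a cube from a corner to a variable point, mapped to `Ω`. -/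
def cubeContraction {n : ℕ} (c : Cube Ω n) (η : Fin n → ℤˣ) : C(unitCube n, C(unitInterval, Ω)) :=
  ContinuousMap.curry
    ⟨fun p => cubeMap c ⟨AffineMap.lineMap (corner η) (p.1 : Fin n → ℝ) (p.2 : ℝ),
      (convex_closedBall _ _).lineMap_mem (corner_mem η) p.1.2 p.2.2⟩, by
      refine (cubeMap c).continuous.comp (Continuous.subtype_mk ?_ _)
      simp only [AffineMap.lineMap_apply_module]
      fun_prop⟩

theorem cubeContraction_apply {n : ℕ} (c : Cube Ω n) (η : Fin n → ℤˣ) (z : unitCube n)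
    (t : unitInterval) :
    cubeContraction c η z t = map n c (AffineMap.lineMap (corner η) (z : Fin n → ℝ) (t : ℝ)) := rfl

/-- The segment from the vertex `v` to a point of its open star. -/
def starSegment (x : openStar v) : C(unitInterval, Ω) :=
  cubeContraction x.2.choose_spec.choose x.2.choose_spec.choose_spec.choose_spec.choose
    ⟨x.2.choose_spec.choose_spec.choose,
      x.2.choose_spec.choose_spec.choose_spec.choose_spec.1⟩

variable {v}

theorem starSegment_eq (hΩ : IsCubeComplex Ω) (hinj : HasDistinctCorners Ω) (x : openStar v) {n : ℕ}
    {c : Cube Ω n} (z : unitCube n) {η : Fin n → ℤˣ} (hx : map n c z = x)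
    (h : IsNear v c z η) : starSegment v x = cubeContraction c η z := by
  ext t
  have hspec := x.2.choose_spec.choose_spec.choose_spec.choose_spec
  exact hspec.2.2.map_lineMap_eq hΩ hinj h hspec.1 z.2 (hspec.2.1.trans hx.symm) t.2

theorem starSegment_mem (x : openStar v) (t : unitInterval) : starSegment v x t ∈ openStar v := by
  have hspec := x.2.choose_spec.choose_spec.choose_spec.choose_spec
  exact ⟨_, _, _, _, (convex_closedBall _ _).lineMap_mem (corner_mem _) hspec.1 t.2, rfl,
    hspec.2.2.lineMap hspec.1 t.2⟩

theorem starSegment_zero (x : openStar v) : starSegment v x 0 = vertexPoint v := by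
  have hspec := x.2.choose_spec.choose_spec.choose_spec.choose_spec
  rw [starSegment, cubeContraction_apply, Set.Icc.coe_zero, AffineMap.lineMap_apply_zero,
    hspec.2.2.corner_eq]

theorem starSegment_one (x : openStar v) : starSegment v x 1 = x := by
  have hspec := x.2.choose_spec.choose_spec.choose_spec.choose_spec
  rw [starSegment, cubeContraction_apply, Set.Icc.coe_one, AffineMap.lineMap_apply_one, hspec.2.1]

/-- With values in a space of paths, continuity is tested cube by cube on the open star alone, not
on its product with the interval. -/
theorem continuous_starSegment [T2Space Ω] (hΩ : IsCubeComplex Ω) (hinj : HasDistinctCorners Ω) :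
    Continuous (starSegment v) := by
  refine continuous_def.2 fun O hO => ?_
  refine isOpen_induced_iff.2 ⟨{x | ∃ hx : x ∈ openStar v, starSegment v ⟨x, hx⟩ ∈ O}, ?_, ?_⟩
  · refine isOpen_of_forall_cube fun n c => ?_
    have h1 : ∀ η : Fin n → ℤˣ, ∃ O' : Set (Fin n → ℝ), IsOpen O' ∧
        Subtype.val ⁻¹' O' = cubeContraction c η ⁻¹' O := fun η =>
      isOpen_induced_iff.1 (hO.preimage (cubeContraction c η).continuous)
    choose O' hO' hO'' using h1
    -- Near each corner of `c` lying at `v`, the segment is the explicit `cubeContraction`.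
    refine ⟨⋃ (η : Fin n → ℤˣ) (_ : map n c (corner η) = vertexPoint v),
      ({z | ∀ i, z i ≠ -((η i : ℤ) : ℝ)} ∩ O' η),
      isOpen_iUnion fun η => isOpen_iUnion fun _ => (isOpen_setOf_ne η).inter (hO' η), ?_⟩
    intro z hz
    have h2 : ∀ η, z ∈ O' η ↔ cubeContraction c η ⟨z, hz⟩ ∈ O := fun η =>
      Set.ext_iff.1 (hO'' η) ⟨z, hz⟩
    simp only [Set.mem_ofPred_eq, Set.mem_iUnion, Set.mem_inter_iff, h2]
    constructor
    · rintro ⟨hx, hx'⟩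
      obtain ⟨η, hη⟩ := (hΩ.map_mem_openStar_iff c hz v).1 hx
      rw [starSegment_eq hΩ hinj _ ⟨z, hz⟩ rfl hη] at hx'
      exact ⟨η, hη.corner_eq, hη.ne, hx'⟩
    · rintro ⟨η, hη, hne, hx'⟩
      have hη : IsNear v c z η := ⟨hη, hne⟩
      refine ⟨(hΩ.map_mem_openStar_iff c hz v).2 ⟨η, hη⟩, ?_⟩
      rwa [starSegment_eq hΩ hinj _ ⟨z, hz⟩ rfl hη]
  · ext x
    exact ⟨fun ⟨_, h⟩ => h, fun h => ⟨x.2, h⟩⟩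

theorem contractibleSpace_openStar [T2Space Ω] (hΩ : IsCubeComplex Ω)
    (hinj : HasDistinctCorners Ω) (v : Vertex Ω) : ContractibleSpace (openStar v) := by
  refine contractible_iff_id_nullhomotopic _ |>.2 ⟨⟨_, vertexPoint_mem_openStar v⟩, ?_⟩
  refine ContinuousMap.Homotopic.symm ⟨⟨⟨fun p => ⟨starSegment v p.2 p.1, starSegment_mem _ _⟩,
    ?_⟩, fun x => ?_, fun x => ?_⟩⟩
  · refine Continuous.subtype_mk ?_ _
    have := continuous_starSegment (v := v) hΩ hinj
    fun_prop
  · exact Subtype.ext (starSegment_zero x)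
  · exact Subtype.ext (starSegment_one x)

end Contraction

/-- The inclusion of an open star. -/
def starIncl (v : Vertex Ω) : C(openStar v, Ω) := ⟨Subtype.val, continuous_subtype_val⟩

section StarClass

variable [T2Space Ω] (hΩ : IsCubeComplex Ω) (hinj : HasDistinctCorners Ω)

include hΩ hinj in
theorem simplyConnectedSpace_openStar (v : Vertex Ω) : SimplyConnectedSpace (openStar v) :=
  have := contractibleSpace_openStar hΩ hinj v
  inferInstance

/-- The homotopy class of any path in an open star. -/
def starClass (v : Vertex Ω) {x y : Ω} (hx : x ∈ openStar v) (hy : y ∈ openStar v) :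
    Path.Homotopic.Quotient x y :=
  have := simplyConnectedSpace_openStar hΩ hinj v
  via (starIncl v) ⟨x, hx⟩ ⟨y, hy⟩ rfl rfl

theorem starClass_self (v : Vertex Ω) {x : Ω} (hx : x ∈ openStar v) :
    starClass hΩ hinj v hx hx = Path.Homotopic.Quotient.refl x :=
  have := simplyConnectedSpace_openStar hΩ hinj v
  via_self (starIncl v) _ rfl

theorem starClass_trans (v : Vertex Ω) {x y z : Ω} (hx : x ∈ openStar v) (hy : y ∈ openStar v)
    (hz : z ∈ openStar v) :
    (starClass hΩ hinj v hx hy).trans (starClass hΩ hinj v hy hz) = starClass hΩ hinj v hx hz :=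
  have := simplyConnectedSpace_openStar hΩ hinj v
  via_trans (starIncl v) _ _ _ rfl rfl rfl

theorem mk_eq_starClass (v : Vertex Ω) {x y : Ω} (γ : Path x y) (h : ∀ t, γ t ∈ openStar v) :
    Path.Homotopic.Quotient.mk γ = starClass hΩ hinj v (by simpa using h 0) (by simpa using h 1) :=
  have := simplyConnectedSpace_openStar hΩ hinj v
  mk_eq_via (starIncl v) γ ⟨⟨fun t => ⟨γ t, h t⟩, by fun_prop⟩, by simp, by simp⟩ fun _ => rfl

/-- Within an open star, a point is joined to the vertex within any cube that contains the point. -/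
theorem starClass_eq_cubeClass (v : Vertex Ω) {n : ℕ} {c : Cube Ω n} {z : Fin n → ℝ}
    {η : Fin n → ℤˣ} (hz : z ∈ unitCube n) (h : IsNear v c z η) {x : Ω} (hx : x ∈ openStar v)
    (hzx : map n c z = x) :
    starClass hΩ hinj v (vertexPoint_mem_openStar v) hx =
      cubeClass c (corner_mem η) hz h.corner_eq hzx := by
  have := simplyConnectedSpace_openStar hΩ hinj v
  subst hzx
  let σ := cubeSegment (⟨_, corner_mem η⟩ : unitCube n) ⟨z, hz⟩
  let γ : Path (⟨vertexPoint v, vertexPoint_mem_openStar v⟩ : openStar v) ⟨map n c z, hx⟩ :=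
    { toFun := fun t => ⟨cubeMap c (σ t), n, c, _, η, (σ t).2, rfl, h.lineMap hz t.2⟩
      continuous_toFun := Continuous.subtype_mk ((cubeMap c).continuous.comp σ.continuous) _
      source' := Subtype.ext ((congrArg (cubeMap c) σ.source).trans h.corner_eq)
      target' := Subtype.ext (congrArg (cubeMap c) σ.target) }
  exact via_eq_via (starIncl v) (cubeMap c) γ σ (fun t => rfl) rfl rfl h.corner_eq rfl

end StarClass

end Stars

section Holonomy

/-! ### The covering space with fiber `W_Γ` and its monodromy -/

theorem map_via {X Y S : Type*} [TopologicalSpace X] [TopologicalSpace Y] [TopologicalSpace S]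
    [SimplyConnectedSpace S] (F : C(S, X)) (f : C(X, Y)) (a b : S) :
    (via F a b rfl rfl).map f = via (f.comp F) a b rfl rfl := by
  rw [via, via, Path.Homotopic.Quotient.cast_rfl_rfl, Path.Homotopic.Quotient.map_comp,
    Path.Homotopic.Quotient.cast_rfl_rfl]

variable {Ω : Type*} [TopologicalSpace Ω] [CWComplex (Set.univ : Set Ω)]
  {V : Type*} {Γ : SimpleGraph V} {lab : Edge Ω → V}

/-- Both sides can be computed in the smallest cube containing the point, where distinct corners
leave one choice for `v` and one for `w`. -/
theorem cubeHom_eq_of_isNear (hΩ : IsCubeComplex Ω) (hlab : IsLabeling Γ lab)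
    (hinj : HasDistinctCorners Ω) {v w : Vertex Ω} {n n' : ℕ} {c : Cube Ω n} {c' : Cube Ω n'}
    {z : Fin n → ℝ} {z' : Fin n' → ℝ} {η ζ : Fin n → ℤˣ} {η' ζ' : Fin n' → ℤˣ}
    (hz : z ∈ unitCube n) (hz' : z' ∈ unitCube n') (heq : map n c z = map n' c' z')
    (hv : IsNear v c z η) (hw : IsNear w c z ζ) (hv' : IsNear v c' z' η')
    (hw' : IsNear w c' z' ζ') : cubeHom hΩ hlab c (η * ζ) = cubeHom hΩ hlab c' (η' * ζ') := by
  obtain ⟨k, pos, ε, d, y, hf, hy, rfl⟩ := hΩ.exists_isFace c hz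
  obtain ⟨k', pos', ε', d', y', hf', hy', rfl⟩ := hΩ.exists_isFace c' hz'
  rw [hf.map_eq y (Metric.ball_subset_closedBall hy),
    hf'.map_eq y' (Metric.ball_subset_closedBall hy')] at heq
  cases eq_of_map_eq_map hy hy' heq
  have h1 := hinj k d _ _ ((hf.isNear hy hv).corner_eq.trans (hf'.isNear hy hv').corner_eq.symm)
  have h2 := hinj k d _ _ ((hf.isNear hy hw).corner_eq.trans (hf'.isNear hy hw').corner_eq.symm)
  rw [← hf.faceSign_eq hv, ← hf.faceSign_eq hw, hf.cubeHom_faceSign hΩ hlab,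
    ← hf'.faceSign_eq hv', ← hf'.faceSign_eq hw', hf'.cubeHom_faceSign hΩ hlab, h1, h2]

open Classical in
/-- The element of `W_Γ` by which the trivializations over the open stars of `v` and `w` differ
at `x`: the label of a path from `v` to `w` in a cube that contains `x`. -/
def starHol (hΩ : IsCubeComplex Ω) (hlab : IsLabeling Γ lab) (v w : Vertex Ω) (x : Ω) : RACG Γ :=
  if h : ∃ (g : RACG Γ) (n : ℕ) (c : Cube Ω n) (z : Fin n → ℝ) (η ζ : Fin n → ℤˣ),
      z ∈ unitCube n ∧ map n c z = x ∧ IsNear v c z η ∧ IsNear w c z ζ ∧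
        g = cubeHom hΩ hlab c (η * ζ)
  then h.choose else 1

section

variable (hΩ : IsCubeComplex Ω) (hlab : IsLabeling Γ lab) (hinj : HasDistinctCorners Ω)

include hinj in
theorem starHol_eq {v w : Vertex Ω} {n : ℕ} {c : Cube Ω n} {z : Fin n → ℝ} {η ζ : Fin n → ℤˣ}
    (hz : z ∈ unitCube n) (hv : IsNear v c z η) (hw : IsNear w c z ζ) {x : Ω} (hx : map n c z = x) :
    starHol hΩ hlab v w x = cubeHom hΩ hlab c (η * ζ) := by
  have h : ∃ (g : RACG Γ) (n : ℕ) (c : Cube Ω n) (z : Fin n → ℝ) (η ζ : Fin n → ℤˣ),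
      z ∈ unitCube n ∧ map n c z = x ∧ IsNear v c z η ∧ IsNear w c z ζ ∧
        g = cubeHom hΩ hlab c (η * ζ) := ⟨_, n, c, z, η, ζ, hz, hx, hv, hw, rfl⟩
  rw [starHol, dif_pos h]
  obtain ⟨n', c', z', η', ζ', hz', hx', hv', hw', hg⟩ := h.choose_spec
  rw [hg]
  exact cubeHom_eq_of_isNear hΩ hlab hinj hz' hz (hx'.trans hx.symm) hv' hw' hv hw

include hinj in
theorem starHol_self {v : Vertex Ω} {x : Ω} (hx : x ∈ openStar v) : starHol hΩ hlab v v x = 1 := by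
  obtain ⟨n, c, z, η, hz, hzx, h⟩ := hx
  rw [starHol_eq hΩ hlab hinj hz h h hzx, cubeHom_self_mul_self]

-- The cocycle condition: a cube containing `x` has all three vertices as corners near `x`.
include hinj in
theorem starHol_mul {v w u : Vertex Ω} {x : Ω} (hv : x ∈ openStar v) (hw : x ∈ openStar w)
    (hu : x ∈ openStar u) :
    starHol hΩ hlab v w x * starHol hΩ hlab w u x = starHol hΩ hlab v u x := by
  obtain ⟨n, c, z, η, hz, rfl, h⟩ := hv
  obtain ⟨η', h'⟩ := (hΩ.map_mem_openStar_iff c hz w).1 hw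
  obtain ⟨η'', h''⟩ := (hΩ.map_mem_openStar_iff c hz u).1 hu
  rw [starHol_eq hΩ hlab hinj hz h h' rfl, starHol_eq hΩ hlab hinj hz h' h'' rfl,
    starHol_eq hΩ hlab hinj hz h h'' rfl, cubeHom_mul_mul]

-- Local constancy of the transition functions, as needed for a discrete fiber.
include hinj in
theorem isOpen_starHol_preimage [T2Space Ω] (v w : Vertex Ω) (O : Set (RACG Γ)) :
    IsOpen (openStar v ∩ openStar w ∩ starHol hΩ hlab v w ⁻¹' O) := by
  refine isOpen_of_forall_cube fun n c => ?_
  refine ⟨⋃ (η : Fin n → ℤˣ) (ζ : Fin n → ℤˣ) (_ : map n c (corner η) = vertexPoint v)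
    (_ : map n c (corner ζ) = vertexPoint w) (_ : cubeHom hΩ hlab c (η * ζ) ∈ O),
    ({z | ∀ i, z i ≠ -((η i : ℤ) : ℝ)} ∩ {z | ∀ i, z i ≠ -((ζ i : ℤ) : ℝ)}), ?_, fun z hz => ?_⟩
  · exact isOpen_iUnion fun η => isOpen_iUnion fun ζ => isOpen_iUnion fun _ => isOpen_iUnion fun _ =>
      isOpen_iUnion fun _ => (isOpen_setOf_ne η).inter (isOpen_setOf_ne ζ)
  · simp only [Set.mem_inter_iff, Set.mem_preimage, hΩ.map_mem_openStar_iff c hz, Set.mem_iUnion,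
      Set.mem_ofPred_eq]
    constructor
    · rintro ⟨⟨⟨η, h⟩, ⟨ζ, h'⟩⟩, hO⟩
      rw [starHol_eq hΩ hlab hinj hz h h' rfl] at hO
      exact ⟨η, ζ, h.corner_eq, h'.corner_eq, hO, h.ne, h'.ne⟩
    · rintro ⟨η, ζ, h1, h2, hO, h3, h4⟩
      have h : IsNear v c z η := ⟨h1, h3⟩
      have h' : IsNear w c z ζ := ⟨h2, h4⟩
      refine ⟨⟨⟨η, h⟩, ⟨ζ, h'⟩⟩, ?_⟩
      rwa [starHol_eq hΩ hlab hinj hz h h' rfl]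

/-- A path between two corners of a cube, followed by the segment to a point near both of them,
is homotopic to the segment to this point. -/
theorem cubeClass_trans_starClass [T2Space Ω] {v w : Vertex Ω} {n : ℕ} {c : Cube Ω n}
    {z : Fin n → ℝ} {η ζ : Fin n → ℤˣ} (hz : z ∈ unitCube n) (hv : IsNear v c z η)
    (hw : IsNear w c z ζ) {x : Ω} (hx : map n c z = x) (hxv : x ∈ openStar v)
    (hxw : x ∈ openStar w) :
    (cubeClass c (corner_mem η) (corner_mem ζ) hv.corner_eq hw.corner_eq).trans
      (starClass hΩ hinj w (vertexPoint_mem_openStar w) hxw) =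
    starClass hΩ hinj v (vertexPoint_mem_openStar v) hxv := by
  rw [starClass_eq_cubeClass hΩ hinj w hz hw hxw hx, starClass_eq_cubeClass hΩ hinj v hz hv hxv hx,
    cubeClass_trans]

section Bundle

variable [T2Space Ω] [TopologicalSpace (RACG Γ)] [DiscreteTopology (RACG Γ)]

/-- The principal bundle over `Ω` with fiber `W_Γ` whose holonomy along simplicial paths is given
by their labels. -/
def holonomyBundle : FiberBundleCore (Vertex Ω) Ω (RACG Γ) where
  baseSet := openStar
  isOpen_baseSet := hΩ.isOpen_openStar
  indexAt x := (hΩ.exists_mem_openStar x).choose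
  mem_baseSet_at x := (hΩ.exists_mem_openStar x).choose_spec
  -- Multiplication on the right, so that labels accumulate from left to right along a path.
  coordChange v w x g := g * starHol hΩ hlab v w x
  coordChange_self v x hx g := by rw [starHol_self hΩ hlab hinj hx, mul_one]
  continuousOn_coordChange v w := by
    have h1 : ContinuousOn (starHol hΩ hlab v w) (openStar v ∩ openStar w) :=
      (continuousOn_open_iff ((hΩ.isOpen_openStar v).inter (hΩ.isOpen_openStar w))).2
        fun O _ => isOpen_starHol_preimage hΩ hlab hinj v w O
    have h2 : Continuous fun p : RACG Γ × RACG Γ => p.1 * p.2 := continuous_of_discreteTopology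
    exact h2.comp_continuousOn
      (continuousOn_snd.prodMk (h1.comp continuousOn_fst fun p hp => hp.1))
  coordChange_comp v w u x hx g := by
    rw [mul_assoc, starHol_mul hΩ hlab hinj hx.1.1 hx.1.2 hx.2]

theorem isCoveringMap_holonomyBundle :
    IsCoveringMap (holonomyBundle hΩ hlab hinj).proj :=
  FiberBundle.isCoveringMap (F := RACG Γ) (E := (holonomyBundle hΩ hlab hinj).Fiber)

/-- The point of the bundle over `x` with coordinate `g` in the trivialization over the open star
of `v`. -/
def starPoint (v : Vertex Ω) (g : RACG Γ) (x : Ω) : (holonomyBundle hΩ hlab hinj).TotalSpace :=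
  ⟨x, g * starHol hΩ hlab v ((holonomyBundle hΩ hlab hinj).indexAt x) x⟩

theorem mem_openStar_indexAt (x : Ω) :
    x ∈ openStar ((holonomyBundle hΩ hlab hinj).indexAt x) :=
  (holonomyBundle hΩ hlab hinj).mem_baseSet_at x

theorem continuousOn_starPoint (v : Vertex Ω) (g : RACG Γ) :
    ContinuousOn (starPoint hΩ hlab hinj v g) (openStar v) := by
  have h1 := ((holonomyBundle hΩ hlab hinj).localTriv v).toOpenPartialHomeomorph.continuousOn_symm
  refine (h1.comp (f := fun x : Ω => (x, g)) (by fun_prop) fun x hx => ?_)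
  exact ((holonomyBundle hΩ hlab hinj).mem_localTriv_target v (x, g)).2 hx

theorem starPoint_eq_starPoint {v w : Vertex Ω} (g : RACG Γ) {x : Ω} (hv : x ∈ openStar v)
    (hw : x ∈ openStar w) :
    starPoint hΩ hlab hinj v g x = starPoint hΩ hlab hinj w (g * starHol hΩ hlab v w x) x := by
  rw [starPoint, starPoint, mul_assoc,
    starHol_mul hΩ hlab hinj hv hw (mem_openStar_indexAt hΩ hlab hinj x)]

theorem starPoint_injective (v : Vertex Ω) (x : Ω) {g g' : RACG Γ}
    (h : starPoint hΩ hlab hinj v g x = starPoint hΩ hlab hinj v g' x) : g = g' := by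
  have h1 := eq_of_heq (Bundle.TotalSpace.mk.inj h).2
  exact mul_right_cancel h1

/-- The section with constant coordinate `g` over the star lifts every path in it. -/
theorem monodromy_starClass (v : Vertex Ω) (g : RACG Γ) {x y : Ω} (hx : x ∈ openStar v)
    (hy : y ∈ openStar v) :
    (isCoveringMap_holonomyBundle hΩ hlab hinj).monodromy (starClass hΩ hinj v hx hy)
      ⟨starPoint hΩ hlab hinj v g x, rfl⟩ = ⟨starPoint hΩ hlab hinj v g y, rfl⟩ := by
  have := simplyConnectedSpace_openStar hΩ hinj v
  let F : C(openStar v, (holonomyBundle hΩ hlab hinj).TotalSpace) :=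
    ⟨fun x => starPoint hΩ hlab hinj v g x, (continuousOn_starPoint hΩ hlab hinj v g).domRestrict⟩
  refine (isCoveringMap_holonomyBundle hΩ hlab hinj).monodromy_eq_of_map_eq
    (via F ⟨x, hx⟩ ⟨y, hy⟩ rfl rfl) ?_
  exact map_via F _ _ _

/-- The midpoint of the edge lies in both stars; passing there from one trivialization to the other
multiplies the coordinate by the label. -/
theorem monodromy_edgeClass {v w : Vertex Ω} (g : RACG Γ) (e : Edge Ω) (u : ℤˣ)
    (hv : endpoint e (-u) = vertexPoint v) (hw : endpoint e u = vertexPoint w) :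
    (isCoveringMap_holonomyBundle hΩ hlab hinj).monodromy (EdgePath.edgeClass e u hv hw)
      ⟨starPoint hΩ hlab hinj v g (vertexPoint v), rfl⟩ =
      ⟨starPoint hΩ hlab hinj w (g * (standardSystem Γ).simple (lab e)) (vertexPoint w), rfl⟩ := by
  have h1 := isOrientedEdgeAt_self e u
  have h0 : (0 : Fin 1 → ℝ) ∈ unitCube 1 := by simp
  have hne : ∀ (η : Fin 1 → ℤˣ) (i : Fin 1), (0 : Fin 1 → ℝ) i ≠ -((η i : ℤ) : ℝ) := fun η i h => by
    have := abs_sign (η i)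
    rw [Pi.zero_apply] at h
    rw [show ((η i : ℤ) : ℝ) = 0 by linarith, abs_zero] at this
    exact zero_ne_one this
  have hnv : IsNear v e 0 (fun _ => -u) := ⟨h1.endpoint_neg.symm.trans hv, hne _⟩
  have hnw : IsNear w e 0 (flip 0 fun _ => -u) := ⟨h1.endpoint_self.symm.trans hw, hne _⟩
  have hmv : map 1 e 0 ∈ openStar v := ⟨1, e, 0, _, h0, rfl, hnv⟩
  have hmw : map 1 e 0 ∈ openStar w := ⟨1, e, 0, _, h0, rfl, hnw⟩
  have h2 : EdgePath.edgeClass e u hv hw =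
      (starClass hΩ hinj v (vertexPoint_mem_openStar v) hmv).trans
        (starClass hΩ hinj w hmw (vertexPoint_mem_openStar w)) := by
    rw [← cubeClass_trans_starClass hΩ hinj h0 hnv hnw rfl hmv hmw,
      Path.Homotopic.Quotient.trans_assoc, starClass_trans, starClass_self,
      Path.Homotopic.Quotient.trans_refl, h1.edgeClass_eq]
  have h3 : starHol hΩ hlab v w (map 1 e 0) = (standardSystem Γ).simple (lab e) := by
    rw [starHol_eq hΩ hlab hinj h0 hnv hnw rfl, cubeHom_flip_mul hΩ hlab _ _ _ 0,
      cubeHom_self_mul_self, mul_one, hlab.lab_eq hΩ h1.isEdgeAt]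
  have h4 := starPoint_eq_starPoint hΩ hlab hinj g hmv hmw
  rw [h3] at h4
  rw [h2, IsCoveringMap.monodromy_trans_apply, monodromy_starClass]
  have h5 : (⟨starPoint hΩ hlab hinj v g (map 1 e 0), rfl⟩ :
      (holonomyBundle hΩ hlab hinj).proj ⁻¹' {map 1 e 0}) = ⟨starPoint hΩ hlab hinj w
        (g * (standardSystem Γ).simple (lab e)) (map 1 e 0), rfl⟩ := Subtype.ext h4
  rw [h5, monodromy_starClass]

theorem monodromy_toClass {v w : Vertex Ω} (p : EdgePath v w) (g : RACG Γ) :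
    (isCoveringMap_holonomyBundle hΩ hlab hinj).monodromy p.toClass
      ⟨starPoint hΩ hlab hinj v g (vertexPoint v), rfl⟩ =
      ⟨starPoint hΩ hlab hinj w (g * evalWord Γ (p.label lab)) (vertexPoint w), rfl⟩ := by
  induction p generalizing g with
  | nil v =>
    rw [EdgePath.toClass_nil, IsCoveringMap.monodromy_refl]
    simp [EdgePath.label, evalWord]
  | cons e u hv hv' p ih =>
    rw [EdgePath.toClass_cons, IsCoveringMap.monodromy_trans_apply, monodromy_edgeClass, ih]
    simp only [EdgePath.label, evalWord, CoxeterSystem.wordProd_cons, mul_assoc]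

end Bundle

include hΩ hlab hinj in
/-- The element of `W_Γ` represented by the label of a simplicial path is a homotopy invariant. -/
theorem evalWord_label_eq_of_toClass_eq [T2Space Ω] {v w : Vertex Ω} {p q : EdgePath v w}
    (h : p.toClass = q.toClass) :
    evalWord Γ (p.label lab) = evalWord Γ (q.label lab) := by
  let _ : TopologicalSpace (RACG Γ) := ⊥
  have : DiscreteTopology (RACG Γ) := ⟨rfl⟩
  -- Monodromy depends only on the homotopy class, and started at coordinate 1 it returns the value
  -- of the label.
  have h1 := monodromy_toClass hΩ hlab hinj p 1
  rw [h, monodromy_toClass hΩ hlab hinj q 1, one_mul, one_mul] at h1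
  exact (starPoint_injective hΩ hlab hinj w _ (congrArg Subtype.val h1)).symm

end

end Holonomy

section Approximation

/-! ### Paths are homotopic to simplicial paths -/

variable {Ω : Type*} [TopologicalSpace Ω] [CWComplex (Set.univ : Set Ω)] [T2Space Ω]
  {V : Type*} {Γ : SimpleGraph V} {lab : Edge Ω → V}
  (hΩ : IsCubeComplex Ω) (hlab : IsLabeling Γ lab) (hinj : HasDistinctCorners Ω)

-- A cube containing `x` has corners at `v` and `w`; the path runs between them inside it.
include hlab in
theorem exists_edgePath_trans_starClass {v w : Vertex Ω} {x : Ω} (hv : x ∈ openStar v)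
    (hw : x ∈ openStar w) : ∃ p : EdgePath v w,
      starClass hΩ hinj v (vertexPoint_mem_openStar v) hv =
        p.toClass.trans (starClass hΩ hinj w (vertexPoint_mem_openStar w) hw) := by
  obtain ⟨n, c, z, η, hz, rfl, h⟩ := id hv
  obtain ⟨ζ, h'⟩ := (hΩ.map_mem_openStar_iff c hz w).1 hw
  obtain ⟨p, -, hp⟩ := exists_edgePath_cube hΩ hlab c η ζ h.corner_eq h'.corner_eq
  exact ⟨p, by rw [hp, cubeClass_trans_starClass hΩ hinj hz h h' rfl hv hw]⟩

/-- The class `a` from `x` to `y`, preceded by a path from `v` to `x` in the open star of `v`, is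
the class of a simplicial path followed by a path in an open star. -/
def IsSimplicial (v : Vertex Ω) {x y : Ω} (hx : x ∈ openStar v)
    (a : Path.Homotopic.Quotient x y) : Prop :=
  ∃ (w : Vertex Ω) (hy : y ∈ openStar w) (p : EdgePath v w),
    (starClass hΩ hinj v (vertexPoint_mem_openStar v) hx).trans a =
      p.toClass.trans (starClass hΩ hinj w (vertexPoint_mem_openStar w) hy)

theorem IsSimplicial.of_cast {v : Vertex Ω} {x y x' y' : Ω} {hx : x ∈ openStar v}
    {a : Path.Homotopic.Quotient x y} (h0 : x' = x) (h1 : y' = y)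
    (h : IsSimplicial hΩ hinj v (h0 ▸ hx) (a.cast h0 h1)) : IsSimplicial hΩ hinj v hx a := by
  subst h0 h1
  rwa [Path.Homotopic.Quotient.cast_rfl_rfl] at h

-- By compactness the path splits into finitely many pieces, each in one open star; the simplicial
-- path is extended whenever the star changes.
include hlab in
theorem isSimplicial_mk {v : Vertex Ω} {x y : Ω} (hx : x ∈ openStar v) (γ : Path x y) :
    IsSimplicial hΩ hinj v hx (Path.Homotopic.Quotient.mk γ) := by
  obtain ⟨t, ht0, htm, ⟨n, htn⟩, hts⟩ := exists_monotone_Icc_subset_open_cover_unitInterval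
    (fun w : Vertex Ω => (hΩ.isOpen_openStar w).preimage γ.continuous) fun s _ =>
      Set.mem_iUnion.2 (hΩ.exists_mem_openStar (γ s))
  have hx0 : γ 0 ∈ openStar v := by rwa [γ.source]
  let P (s : unitInterval) : Prop :=
    IsSimplicial hΩ hinj v hx0 (Path.Homotopic.Quotient.mk (γ.subpath 0 s))
  have h0 : P 0 := by
    refine ⟨v, hx0, .nil v, ?_⟩
    rw [Path.subpath_self, Path.Homotopic.Quotient.mk_refl, Path.Homotopic.Quotient.trans_refl,
      EdgePath.toClass_nil, Path.Homotopic.Quotient.refl_trans]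
  have hstep : ∀ m, P (t m) → P (t (m + 1)) := by
    rintro m ⟨w, hw, p, hp⟩
    obtain ⟨w', hw'⟩ := hts m
    have hle := htm (Nat.le_add_right m 1)
    have hsub : ∀ s, γ.subpath (t m) (t (m + 1)) s ∈ openStar w' := fun s => by
      have : γ.subpath (t m) (t (m + 1)) s ∈ γ '' Set.Icc (t m) (t (m + 1)) := by
        rw [← Path.range_subpath_of_le γ _ _ hle]
        exact Set.mem_range_self s
      obtain ⟨r, hr, hr'⟩ := this
      rw [← hr']
      exact hw' hr
    have hm : γ (t m) ∈ openStar w' := hw' ⟨le_rfl, hle⟩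
    have hm' : γ (t (m + 1)) ∈ openStar w' := hw' ⟨hle, le_rfl⟩
    obtain ⟨q, hq⟩ := exists_edgePath_trans_starClass hΩ hlab hinj hw hm
    refine ⟨w', hm', p.append q, ?_⟩
    have h1 : Path.Homotopic.Quotient.mk (γ.subpath 0 (t (m + 1))) =
        (Path.Homotopic.Quotient.mk (γ.subpath 0 (t m))).trans
          (Path.Homotopic.Quotient.mk (γ.subpath (t m) (t (m + 1)))) := by
      rw [← Path.Homotopic.Quotient.mk_trans]
      exact (Path.Homotopic.Quotient.eq.2 ⟨Path.Homotopy.subpathTransSubpath γ _ _ _⟩).symm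
    rw [h1, ← Path.Homotopic.Quotient.trans_assoc, hp, hq, mk_eq_starClass hΩ hinj w' _ hsub,
      Path.Homotopic.Quotient.trans_assoc, Path.Homotopic.Quotient.trans_assoc, starClass_trans,
      EdgePath.toClass_append, Path.Homotopic.Quotient.trans_assoc]
  have hall : ∀ m, P (t m) := fun m => by
    induction m with
    | zero => rwa [ht0]
    | succ m ih => exact hstep m ih
  have h1 : P 1 := htn n le_rfl ▸ hall n
  refine IsSimplicial.of_cast hΩ hinj γ.source γ.target ?_
  rw [← Path.Homotopic.Quotient.mk_cast, ← Path.subpath_zero_one]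
  exact h1

include hΩ hlab hinj in
/-- Every path between vertices is homotopic to a simplicial path. -/
theorem exists_toClass_eq {v w : Vertex Ω}
    (a : Path.Homotopic.Quotient (vertexPoint v) (vertexPoint w)) :
    ∃ p : EdgePath v w, p.toClass = a := by
  obtain ⟨γ, rfl⟩ := Path.Homotopic.Quotient.mk_surjective a
  obtain ⟨w', hw', p, hp⟩ := isSimplicial_mk hΩ hlab hinj (vertexPoint_mem_openStar v) γ
  obtain ⟨q, hq⟩ := exists_edgePath_trans_starClass hΩ hlab hinj hw' (vertexPoint_mem_openStar w)
  refine ⟨p.append q, ?_⟩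
  rw [hq, starClass_self, starClass_self, Path.Homotopic.Quotient.trans_refl,
    Path.Homotopic.Quotient.refl_trans] at hp
  rw [hp, EdgePath.toClass_append]

include hΩ hlab hinj in
theorem nonempty_path [ConnectedSpace Ω] (B : Vertex Ω) (x : Ω) :
    Nonempty (Path (vertexPoint B) x) := by
  obtain ⟨v, hv⟩ := hΩ.exists_mem_openStar x
  obtain ⟨p⟩ := exists_edgePath hΩ hlab B v
  obtain ⟨γ, -⟩ := Path.Homotopic.Quotient.mk_surjective
    (starClass hΩ hinj v (vertexPoint_mem_openStar v) hv)
  exact ⟨p.toPath.trans γ⟩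

end Approximation

section Reduction

/-! ### Simplicial paths with trivial label -/

variable {Ω : Type*} [TopologicalSpace Ω] [CWComplex (Set.univ : Set Ω)]
  {V : Type*} {Γ : SimpleGraph V} {lab : Edge Ω → V}

/-- Two consecutive edges with commuting labels can be replaced by the opposite two edges of a
square. -/
theorem exists_swap (hfull : IsCubeFull Γ lab) {v v' w : Vertex Ω} (e e' : Edge Ω) (u u' : ℤˣ)
    (hv : endpoint e (-u) = vertexPoint v) (hv' : endpoint e u = vertexPoint v')
    (hw : endpoint e' (-u') = vertexPoint v') (hw' : endpoint e' u' = vertexPoint w)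
    (hadj : Γ.Adj (lab e) (lab e')) (hΩ : IsCubeComplex Ω) (hlab : IsLabeling Γ lab)
    (hinj : HasDistinctCorners Ω) :
    ∃ p : EdgePath v w, p.label lab = [lab e', lab e] ∧
      p.toClass = (EdgePath.edgeClass e u hv hv').trans (EdgePath.edgeClass e' u' hw hw') := by
  obtain ⟨c, hc⟩ := hfull 2 v' ![e, e'] le_rfl
    (fun k => by
      refine Fin.cases ?_ (fun k => ?_) k
      · exact ⟨u, hv'⟩
      · obtain rfl := Subsingleton.elim k 0
        exact ⟨-u', hw⟩)
    (fun k l hkl => by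
      fin_cases k <;> fin_cases l
      · exact absurd rfl hkl
      · exact hadj
      · exact hadj.symm
      · exact absurd rfl hkl)
  obtain ⟨_, i, hi⟩ := hc 0
  obtain ⟨_, j, hj⟩ := hc 1
  obtain ⟨α, hα⟩ := IsEdgeAt.exists_oriented_of_orientation (e := e) hi u
  obtain ⟨β, hβ⟩ := IsEdgeAt.exists_oriented_of_orientation (e := e') hj u'
  -- Cube-fullness does not say that the edges meet at one corner of the square; distinct corners
  -- force it, both ends being `v'`.
  obtain rfl : flip i α = β := hinj 2 c _ _
    (by rw [← hα.endpoint_self, hv', ← hw, hβ.endpoint_neg])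
  obtain ⟨v₁, hv₁⟩ := hΩ.exists_vertexPoint_eq c (flip j α)
  obtain ⟨f, hf⟩ := hΩ.exists_isEdgeAt c α j
  obtain ⟨s, hs⟩ := hf.exists_oriented
  obtain ⟨f', hf'⟩ := hΩ.exists_isEdgeAt c (flip j α) i
  obtain ⟨s', hs'⟩ := hf'.exists_oriented
  have hend : endpoint f' s' = vertexPoint w := by
    rw [hs'.endpoint_self, flip_comm, ← hβ.endpoint_self, hw']
  refine ⟨.cons f s (hs.endpoint_neg.trans (hα.endpoint_neg.symm.trans hv))
    (hs.endpoint_self.trans hv₁.symm)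
    (.cons f' s' (hs'.endpoint_neg.trans hv₁.symm) hend (.nil w)), ?_, ?_⟩
  · rw [EdgePath.label, EdgePath.label, EdgePath.label, hlab.lab_eq hΩ hf, hlab.lab_eq hΩ hf',
      hlab.lab_eq hΩ hα.isEdgeAt, hlab.lab_eq hΩ hβ.isEdgeAt]
  · rw [EdgePath.toClass_cons, EdgePath.toClass_cons, EdgePath.toClass_nil,
      Path.Homotopic.Quotient.trans_refl, hs.edgeClass_eq, hs'.edgeClass_eq, hα.edgeClass_eq,
      hβ.edgeClass_eq, cubeClass_trans, cubeClass_trans]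
    simp only [flip_comm i j]

/-- In a folded complex, two consecutive edges with the same label are a backtrack. -/
theorem edgeClass_trans_eq_refl (hfold : IsFolded lab) (hinj : HasDistinctCorners Ω)
    {v v' w : Vertex Ω} (e e' : Edge Ω) (u u' : ℤˣ)
    (hv : endpoint e (-u) = vertexPoint v) (hv' : endpoint e u = vertexPoint v')
    (hw : endpoint e' (-u') = vertexPoint v') (hw' : endpoint e' u' = vertexPoint w)
    (hlab : lab e = lab e') :
    ∃ h : v = w, (EdgePath.edgeClass e u hv hv').trans (EdgePath.edgeClass e' u' hw hw') =
      h ▸ Path.Homotopic.Quotient.refl (vertexPoint v) := by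
  obtain rfl := hfold.edges e e' u (-u') (hv'.trans hw.symm) hlab
  -- The ends of an edge are distinct, so the second traversal reverses the first.
  have h1 : (fun _ : Fin 1 => u) = fun _ => -u' := hinj 1 e _ _ (hv'.trans hw.symm)
  obtain rfl : u' = -u := by rw [congrFun h1 0, neg_neg]
  obtain rfl : v = w := vertexPoint_injective (hv.symm.trans hw')
  refine ⟨rfl, ?_⟩
  have h2 := isOrientedEdgeAt_self e u
  rw [h2.edgeClass_eq, h2.reverse.edgeClass_eq]
  simp only [flip_flip]
  rw [cubeClass_trans, cubeClass_self]

/-- Reductions of the label lift to homotopies with fixed ends: a swap crosses a square, a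
cancellation deletes a backtrack. -/
theorem WordStep.exists_edgePath (hfull : IsCubeFull Γ lab) (hfold : IsFolded lab)
    (hΩ : IsCubeComplex Ω) (hlab : IsLabeling Γ lab) (hinj : HasDistinctCorners Ω)
    {l l' : List V} (h : WordStep Γ l l') {v w : Vertex Ω} (p : EdgePath v w)
    (hp : p.label lab = l) : ∃ q : EdgePath v w, q.label lab = l' ∧ q.toClass = p.toClass := by
  induction h generalizing v with
  | swap s t l hst =>
    match p, hp with
    | .cons e u hv hv' (.cons e' u' hw hw' p), hp =>
      simp only [EdgePath.label, List.cons.injEq] at hp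
      obtain ⟨rfl, rfl, rfl⟩ := hp
      obtain ⟨q, hq, hq'⟩ := exists_swap hfull e e' u u' hv hv' hw hw' hst hΩ hlab hinj
      refine ⟨q.append p, by rw [EdgePath.label_append, hq]; rfl, ?_⟩
      rw [EdgePath.toClass_append, hq', EdgePath.toClass_cons, EdgePath.toClass_cons,
        Path.Homotopic.Quotient.trans_assoc]
  | cancel s l =>
    match p, hp with
    | .cons e u hv hv' (.cons e' u' hw hw' p), hp =>
      simp only [EdgePath.label, List.cons.injEq] at hp
      obtain ⟨rfl, h1, rfl⟩ := hp
      obtain ⟨rfl, h2⟩ := edgeClass_trans_eq_refl hfold hinj e e' u u' hv hv' hw hw' h1.symm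
      refine ⟨p, rfl, ?_⟩
      rw [EdgePath.toClass_cons, EdgePath.toClass_cons, ← Path.Homotopic.Quotient.trans_assoc, h2,
        Path.Homotopic.Quotient.refl_trans]
  | cons s _ ih =>
    match p, hp with
    | .cons e u hv hv' p, hp =>
      simp only [EdgePath.label, List.cons.injEq] at hp
      obtain ⟨rfl, h1⟩ := hp
      obtain ⟨q, hq, hq'⟩ := ih p h1
      exact ⟨.cons e u hv hv' q, by rw [EdgePath.label, hq], by
        rw [EdgePath.toClass_cons, hq', EdgePath.toClass_cons]⟩

/-- A closed simplicial path whose label represents the identity is null-homotopic. -/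
theorem toClass_eq_refl_of_evalWord_eq_one (hfull : IsCubeFull Γ lab) (hfold : IsFolded lab)
    (hΩ : IsCubeComplex Ω) (hlab : IsLabeling Γ lab) (hinj : HasDistinctCorners Ω)
    {v : Vertex Ω} (p : EdgePath v v) (hp : evalWord Γ (p.label lab) = 1) :
    p.toClass = Path.Homotopic.Quotient.refl (vertexPoint v) := by
  have key : ∀ l', Relation.ReflTransGen (WordStep Γ) (p.label lab) l' →
      ∃ q : EdgePath v v, q.label lab = l' ∧ q.toClass = p.toClass := fun l' h => by
    induction h with
    | refl => exact ⟨p, rfl, rfl⟩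
    | tail _ h ih =>
      obtain ⟨q, hq, hq'⟩ := ih
      obtain ⟨r, hr, hr'⟩ := h.exists_edgePath hfull hfold hΩ hlab hinj q hq
      exact ⟨r, hr, hr'.trans hq'⟩
  obtain ⟨q, hq, hq'⟩ := key [] (reflTransGen_nil_of_evalWord_eq_one _ hp)
  rw [← hq']
  match q, hq with
  | .nil _, _ => rfl

theorem toClass_eq_of_evalWord_eq (hfull : IsCubeFull Γ lab) (hfold : IsFolded lab)
    (hΩ : IsCubeComplex Ω) (hlab : IsLabeling Γ lab) (hinj : HasDistinctCorners Ω)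
    {v w : Vertex Ω} {p q : EdgePath v w}
    (h : evalWord Γ (p.label lab) = evalWord Γ (q.label lab)) : p.toClass = q.toClass := by
  have h1 := toClass_eq_refl_of_evalWord_eq_one hfull hfold hΩ hlab hinj (p.append q.reverse) (by
    simp only [EdgePath.label_append, EdgePath.label_reverse, evalWord,
      CoxeterSystem.wordProd_append, CoxeterSystem.wordProd_reverse] at h ⊢
    rw [h, mul_inv_cancel])
  rw [EdgePath.toClass_append, EdgePath.toClass_reverse] at h1
  rw [← Path.Homotopic.Quotient.refl_trans q.toClass, ← h1, Path.Homotopic.Quotient.trans_assoc,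
    Path.Homotopic.Quotient.symm_trans, Path.Homotopic.Quotient.trans_refl]

end Reduction

/-! ### The isomorphism with `G`. -/

section FundamentalGroup

variable {Ω : Type*} [TopologicalSpace Ω] [CWComplex (Set.univ : Set Ω)] [T2Space Ω]
  {V : Type*} {Γ : SimpleGraph V} {lab : Edge Ω → V} {B : Vertex Ω} {G : Subgroup (RACG Γ)}

/-- The isomorphism from the fundamental group of a completion to the subgroup, given by labels of
simplicial loops. -/
theorem IsCompletion.exists_mulEquiv (h : IsCompletion Γ lab B G) (hinj : HasDistinctCorners Ω) :
    ∃ φ : (FundamentalGroup Ω (vertexPoint B))ᵐᵒᵖ ≃* G, ∀ p : EdgePath B B,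
      (φ (MulOpposite.op (FundamentalGroup.fromPath (Path.Homotopic.Quotient.mk p.toPath))) :
        RACG Γ) = evalWord Γ (p.label lab) := by
  choose r hr using fun a : Path.Homotopic.Quotient (vertexPoint B) (vertexPoint B) =>
    exists_toClass_eq h.isCubeComplex h.isLabeling hinj a
  -- One direction makes the label map independent of the representative `r`, the other makes it
  -- injective.
  have hwd : ∀ p q : EdgePath B B, p.toClass = q.toClass ↔
      evalWord Γ (p.label lab) = evalWord Γ (q.label lab) :=
    fun p q => ⟨evalWord_label_eq_of_toClass_eq h.isCubeComplex h.isLabeling hinj,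
      toClass_eq_of_evalWord_eq h.cubeFull h.folded h.isCubeComplex h.isLabeling hinj⟩
  let f : (FundamentalGroup Ω (vertexPoint B))ᵐᵒᵖ →* G := MonoidHom.mk'
    (fun a => ⟨evalWord Γ ((r a.unop).label lab), h.label_mem _⟩) fun a b => by
      refine Subtype.ext ?_
      refine Eq.trans ((hwd _ ((r a.unop).append (r b.unop))).1 ?_) ?_
      · rw [EdgePath.toClass_append, hr, hr, hr]
        rfl
      · rw [EdgePath.label_append]
        exact CoxeterSystem.wordProd_append _ _ _
  refine ⟨MulEquiv.ofBijective f ⟨fun a b hab => ?_, fun g => ?_⟩, fun p => ?_⟩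
  · have h1 := (hwd _ _).2 (congrArg Subtype.val hab)
    rw [hr, hr] at h1
    exact MulOpposite.unop_injective h1
  -- Only reduced words are known to label loops, hence a shortest representative of `g`.
  · obtain ⟨w, hw, hwg⟩ := exists_isReducedWord g.1
    obtain ⟨p, rfl⟩ := h.exists_loop w hw (hwg ▸ g.2)
    refine ⟨MulOpposite.op p.toClass, Subtype.ext (Eq.trans ?_ hwg)⟩
    exact (hwd _ _).1 (hr p.toClass)
  · exact (hwd _ _).1 (hr p.toClass)

end FundamentalGroup

end RACGCompletion

end

/-- Mathlib multiplies in `FundamentalGroup` by `[p] * [q] = [q.trans p]`, so the group in which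
`[p] [q]` is "first `p`, then `q`" is its opposite. -/
theorem mainTheorem8 {V : Type*} [Finite V] (Γ : SimpleGraph V)
    (G : Subgroup (RACGCompletion.RACG Γ))
    (hG : ∀ g ∈ G, IsOfFinOrder g → g = 1)
    {Ω : Type*} [TopologicalSpace Ω] [T2Space Ω] [Topology.CWComplex (Set.univ : Set Ω)]
    (lab : RACGCompletion.Edge Ω → V) (B : RACGCompletion.Vertex Ω)
    (hΩ : RACGCompletion.IsCompletion Γ lab B G) :
    (∀ x : Ω, Nonempty (FundamentalGroup Ω x ≃* G)) ∧
    ∃ φ : (FundamentalGroup Ω (RACGCompletion.vertexPoint B))ᵐᵒᵖ ≃* G,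
      ∀ p : RACGCompletion.EdgePath B B,
        (φ (MulOpposite.op (FundamentalGroup.fromPath (Path.Homotopic.Quotient.mk p.toPath))) :
          RACGCompletion.RACG Γ) = RACGCompletion.evalWord Γ (p.label lab) := by
  have hinj : RACGCompletion.HasDistinctCorners Ω := fun _ c _ _ => hΩ.corner_inj hG c
  obtain ⟨φ, hφ⟩ := hΩ.exists_mulEquiv hinj
  refine ⟨fun x => ?_, φ, hφ⟩
  have := hΩ.connected
  obtain ⟨γ⟩ := RACGCompletion.nonempty_path hΩ.isCubeComplex hΩ.isLabeling hinj B x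
  -- Change of base point, then inversion, which identifies a group with its opposite.
  exact ⟨((FundamentalGroup.fundamentalGroupMulEquivOfPath γ).symm.trans
    (MulEquiv.inv' (FundamentalGroup Ω (RACGCompletion.vertexPoint B)))).trans φ⟩
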